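/- Let $\mathbb T=\mathbb R/2\pi\mathbb Z$ with its normalised Haar measure and, for $q\in\mathbb R$, let $\mathfrak M_q=-\partial_\phi^2+q\sin^2\phi$ be the Mathieu operator, regarded as a self-adjoint operator on $L^2(\mathbb T)$ with domain the Sobolev space $W^{2,2}(\mathbb T)$. For $(i,j)\in\{0,1\}^2$ let $L^2_{(i,j)}(\mathbb T)$ be the $\mathfrak M_q$-invariant subspace of those $f\in L^2(\mathbb T)$ such that $f(-\phi)=(-1)^i f(\phi)$ and $f(\pi+\phi)=(-1)^j f(\phi)$ for almost every $\phi$. The eigenvalues of the restriction of $\mathfrak M_q$ to $L^2_{(i,j)}(\mathbb T)$ form a strictly increasing sequence $$\lambda^q_{(i,j),0}<\lambda^q_{(i,j),1}<\lambda^q_{(i,j),2}<\cdots$$ and, for each $k\in\mathbb N=\{0,1,2,\dots\}$, the function $q\mapsto\lambda^q_{(i,j),k}$ is differentiable on $\mathbb R$. Moreover, for all $(i,j)\in\{0,1\}^2$ and $k\in\mathbb N$, $$\lim_{q\to\infty}\frac{\lambda^q_{(i,j),k}}{q^{1/2}}=2(2k+i)+1 \qquad\text{and}\qquad \lim_{q\to\infty}\frac{q\,\partial_q\lambda^q_{(i,j),k}}{\lambda^q_{(i,j),k}}=\frac12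 .$$ -/

import Mathlib

open Real MeasureTheory Set Filter Topology
open scoped ContDiff

namespace Mathieu

noncomputable section

/-- `2π` is positive, so that `ℝ / 2πℤ` is a compact circle with its normalised Haar measure. -/
instance fact_two_pi_pos : Fact (0 < 2 * π) := ⟨Real.two_pi_pos⟩

/-- The circle `𝕋 = ℝ / 2πℤ`, with angular coordinate `φ`. -/
abbrev Torus : Type := AddCircle (2 * π)

/-- The complex Hilbert space `L²(𝕋)`, for the Haar measure of total mass one. -/
abbrev L2 : Type := Lp ℂ 2 (AddCircle.haarAddCircle (T := 2 * π))

/-- The potential `sin² φ` as a function on the circle. -/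
def sinSq (x : Torus) : ℝ := (Real.Angle.sin x) ^ 2

/-- `g ∈ L²(𝕋)` is the weak second derivative `∂_φ² f` of `f ∈ L²(𝕋)`:
`∫ f ψ'' = ∫ g ψ` for every smooth test function `ψ` on the circle,
that is, every smooth `2π`-periodic function `ψ` of the angular coordinate. -/
def IsWeakSecondDeriv (f g : L2) : Prop :=
  ∀ ψ : ℝ → ℂ, ContDiff ℝ ∞ ψ → Function.Periodic ψ (2 * π) →
    ∫ φ in (0 : ℝ)..(2 * π), f (φ : Torus) * iteratedDeriv 2 ψ φ
      = ∫ φ in (0 : ℝ)..(2 * π), g (φ : Torus) * ψ φ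

/-- The graph of the Mathieu operator `-∂_φ² + q sin² φ` on `L²(𝕋)`, with its self-adjoint domain,
the Sobolev space `W^{2,2}(𝕋)`: `IsMathieuImage q f h` says that `f` has a weak second derivative
in `L²(𝕋)` and that `-∂_φ² f + q sin² φ f = h`. -/
def IsMathieuImage (q : ℝ) (f h : L2) : Prop :=
  ∃ g : L2, IsWeakSecondDeriv f g ∧
    ∀ᵐ x ∂(AddCircle.haarAddCircle (T := 2 * π)),
      h x = - g x + (q : ℂ) * (sinSq x : ℂ) * f x

/-- The parity/periodicity class `L²_{(i,j)}(𝕋)`: those `f ∈ L²(𝕋)` with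
`f(-φ) = (-1)^i f(φ)` and `f(π + φ) = (-1)^j f(φ)`. -/
def InClass (i j : Fin 2) (f : L2) : Prop :=
  (∀ᵐ x ∂(AddCircle.haarAddCircle (T := 2 * π)), f (-x) = (-1 : ℂ) ^ (i : ℕ) * f x) ∧
  (∀ᵐ x ∂(AddCircle.haarAddCircle (T := 2 * π)),
    f (((π : ℝ) : Torus) + x) = (-1 : ℂ) ^ (j : ℕ) * f x)

/-- The set of eigenvalues of the restriction of the (self-adjoint) operator `-∂_φ² + q sin² φ`
to `L²_{(i,j)}(𝕋)`. -/
def eigenvalueSet (i j : Fin 2) (q : ℝ) : Set ℝ :=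
  {μ : ℝ | ∃ f : L2, f ≠ 0 ∧ InClass i j f ∧ IsMathieuImage q f ((μ : ℂ) • f)}

/-- The eigenvalues of `-∂_φ² + q sin² φ` on `L²_{(i,j)}(𝕋)` in increasing order, numbered from
`k = 0`: the first is the least eigenvalue, and each next one is the least eigenvalue that is
larger than the previous one. -/
def eigenvalue (i j : Fin 2) : ℕ → ℝ → ℝ
  | 0, q => sInf (eigenvalueSet i j q)
  | k + 1, q => sInf {μ ∈ eigenvalueSet i j q | eigenvalue i j k q < μ}

end

end Mathieu

/-! Reflection about 0, and reflection about π/2 (reflection about 0 followed by the shift by π),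
turn the class (i, j) into a Sturm–Liouville problem on [0, π/2] with a Neumann or Dirichlet
condition at each end. Writing u = r sin θ and u' = κ r cos θ with a weight κ > 0, the phase obeys
the scalar equation θ' = κ cos² θ + κ⁻¹ (λ - q sin² x) sin² θ. Started from 0 or π/2 according to i,
the value θ(π/2) is positive, continuous and strictly increasing in λ, and unbounded above. The
eigenvalues are the λ at which θ(π/2) equals a member of the increasing sequence `targetAngle i j`;
this gives existence, simplicity and the enumeration `level`. An L² eigenfunction is classical
because its Fourier coefficients are O(n⁻²) and the equation can then be integrated twice.

For differentiability, the Lagrange identity for the eigenfunctions at q and q₀ has no boundary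
terms, since their phases agree at both ends. It expresses the difference quotient of `level` as a
quotient of integrals continuous in q, and the limit is the Feynman–Hellmann formula
`hasDerivAt_level`.

For the growth rate take q = κ⁴, λ = μ κ², t = κ x. The weight-κ phase then belongs to the potential
κ² sin²(t/κ), which tends to t², so it is compared with the phase of the harmonic oscillator, whose
levels of parity i are 2(2k + i) + 1. Above such a level the oscillator phase passes (k + 1)π at a
finite time (`exists_lt_oscillatorAngle`), which bounds the eigenvalue from above
(`level_le_mul_sq`). Below it, a slightly flattened Hermite function controls the phase near the
well and an explicit supersolution controls it up to π/2 (`mul_sq_le_level`).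

For the second limit, ∂_q λ is the mean of sin² over the eigenfunction. A virial identity with
multiplier sin x cos x relates the means of sin² and sin⁴, and two inequalities from positivity of
the kinetic energy show that every term other than 4q⟨sin²⟩ and 2λ is o(λ), so q⟨sin²⟩/λ → 1/2. -/

namespace Mathieu

/-! ### Prüfer angles of first order systems `u' = P z`, `z' = -Q u` -/

/-- Right-hand side of the Prüfer equation of the system `u' = P z`, `z' = -Q u`. -/
noncomputable def pruferField (P Q : ℝ → ℝ) (x v : ℝ) : ℝ :=
  P x * Real.cos v ^ 2 + Q x * Real.sin v ^ 2

/-- `θ` is a Prüfer angle of the system `u' = P z`, `z' = -Q u`. -/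
def IsPruferAngle (P Q θ : ℝ → ℝ) : Prop :=
  ∀ x, HasDerivAt θ (pruferField P Q x (θ x)) x

lemma abs_sin_sq_sub_sin_sq_le (a b : ℝ) : |Real.sin a ^ 2 - Real.sin b ^ 2| ≤ |a - b| := by
  have h : Real.sin a ^ 2 - Real.sin b ^ 2 = Real.sin (a + b) * Real.sin (a - b) := by
    rw [Real.sin_add, Real.sin_sub]
    have h1 := Real.sin_sq_add_cos_sq a
    have h2 := Real.sin_sq_add_cos_sq b
    linear_combination Real.sin b ^ 2 * h1 - Real.sin a ^ 2 * h2
  rw [h, abs_mul]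
  calc |Real.sin (a + b)| * |Real.sin (a - b)| ≤ 1 * |a - b| :=
        mul_le_mul (Real.abs_sin_le_one _) Real.abs_sin_le_abs (abs_nonneg _) zero_le_one
    _ = |a - b| := one_mul _

lemma pruferField_eq (P Q : ℝ → ℝ) (x v : ℝ) :
    pruferField P Q x v = P x + (Q x - P x) * Real.sin v ^ 2 := by
  unfold pruferField
  rw [Real.cos_sq']
  ring

/-- The Lipschitz constant does not depend on the angle; this gives global existence, uniqueness,
comparison and Gronwall estimates alike. -/
lemma abs_pruferField_sub_le (P Q : ℝ → ℝ) (x u v : ℝ) :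
    |pruferField P Q x u - pruferField P Q x v| ≤ |Q x - P x| * |u - v| := by
  rw [pruferField_eq, pruferField_eq]
  have : P x + (Q x - P x) * Real.sin u ^ 2 - (P x + (Q x - P x) * Real.sin v ^ 2)
      = (Q x - P x) * (Real.sin u ^ 2 - Real.sin v ^ 2) := by ring
  rw [this, abs_mul]
  exact mul_le_mul_of_nonneg_left (abs_sin_sq_sub_sin_sq_le u v) (abs_nonneg _)

lemma abs_pruferField_le (P Q : ℝ → ℝ) (x v : ℝ) :
    |pruferField P Q x v| ≤ |P x| + |Q x| := by
  unfold pruferField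
  refine (abs_add_le _ _).trans (add_le_add ?_ ?_)
  · rw [abs_mul, abs_of_nonneg (sq_nonneg (Real.cos v))]
    exact mul_le_of_le_one_right (abs_nonneg _) (Real.cos_sq_le_one v)
  · rw [abs_mul, abs_of_nonneg (sq_nonneg (Real.sin v))]
    exact mul_le_of_le_one_right (abs_nonneg _) (Real.sin_sq_le_one v)

lemma IsPruferAngle.continuous {P Q θ : ℝ → ℝ} (h : IsPruferAngle P Q θ) : Continuous θ :=
  continuous_iff_continuousAt.2 fun x => (h x).continuousAt

/-- A subsolution of a scalar equation starting below a supersolution stays below it. -/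
lemma le_of_subsolution_of_supersolution {F : ℝ → ℝ → ℝ} {K a b : ℝ}
    (hF : ∀ x ∈ Ico a b, ∀ u v, |F x u - F x v| ≤ K * |u - v|)
    {u v u' v' : ℝ → ℝ} (hu : ContinuousOn u (Icc a b)) (hv : ContinuousOn v (Icc a b))
    (hu' : ∀ x ∈ Ico a b, HasDerivWithinAt u (u' x) (Ici x) x)
    (hv' : ∀ x ∈ Ico a b, HasDerivWithinAt v (v' x) (Ici x) x)
    (hsub : ∀ x ∈ Ico a b, u' x ≤ F x (u x)) (hsup : ∀ x ∈ Ico a b, F x (v x) ≤ v' x)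
    (ha : u a ≤ v a) : ∀ x ∈ Icc a b, u x ≤ v x := by
  -- The rate |K| + 1 strictly exceeds the growth that the Lipschitz bound allows, so the gap cannot
  -- cross this barrier; then ε → 0.
  have key : ∀ ε > 0, ∀ x ∈ Icc a b, u x - v x ≤ ε * Real.exp ((|K| + 1) * (x - a)) := by
    intro ε hε
    refine image_le_of_deriv_right_lt_deriv_boundary (f' := fun x => u' x - v' x)
      (B' := fun x => (|K| + 1) * (ε * Real.exp ((|K| + 1) * (x - a))))
      (hu.sub hv) (fun x hx => (hu' x hx).sub (hv' x hx)) ?_ ?_ ?_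
    · simp only [Pi.sub_apply, sub_self, mul_zero, Real.exp_zero, mul_one]
      linarith
    · intro x
      have h1 : HasDerivAt (fun x : ℝ => (|K| + 1) * (x - a)) (|K| + 1) x := by
        simpa using ((hasDerivAt_id x).sub_const a).const_mul (|K| + 1)
      convert! h1.exp.const_mul ε using 1
      ring
    · intro x hx hxe
      simp only [Pi.sub_apply] at hxe
      have hpos : 0 < ε * Real.exp ((|K| + 1) * (x - a)) := by positivity
      have h1 := hF x hx (u x) (v x)
      rw [hxe, abs_of_pos hpos] at h1
      have h2 := (le_abs_self _).trans h1
      have h3 := hsub x hx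
      have h4 := hsup x hx
      have h5 : K * (ε * Real.exp ((|K| + 1) * (x - a)))
          ≤ |K| * (ε * Real.exp ((|K| + 1) * (x - a))) :=
        mul_le_mul_of_nonneg_right (le_abs_self K) hpos.le
      linarith
  intro x hx
  have hlim : Tendsto (fun ε : ℝ => ε * Real.exp ((|K| + 1) * (x - a))) (𝓝[>] 0) (𝓝 0) := by
    have : Tendsto (fun ε : ℝ => ε * Real.exp ((|K| + 1) * (x - a))) (𝓝 0)
        (𝓝 (0 * Real.exp ((|K| + 1) * (x - a)))) := tendsto_id.mul_const _
    rw [zero_mul] at this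
    exact this.mono_left nhdsWithin_le_nhds
  have := ge_of_tendsto hlim (eventually_nhdsWithin_of_forall fun ε hε => key ε hε x hx)
  linarith

lemma exists_bound_on_Icc {f : ℝ → ℝ} (hf : Continuous f) (a b : ℝ) :
    ∃ C, 0 ≤ C ∧ ∀ x ∈ Icc a b, |f x| ≤ C := by
  obtain ⟨C, hC⟩ := isCompact_Icc.exists_bound_of_continuousOn (hf.continuousOn (s := Icc a b))
  exact ⟨max C 0, le_max_right _ _, fun x hx => (hC x hx).trans (le_max_left _ _)⟩

lemma IsPruferAngle.le_of_supersolution {P Q θ : ℝ → ℝ} (hP : Continuous P) (hQ : Continuous Q)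
    (h : IsPruferAngle P Q θ) {a b : ℝ} {v v' : ℝ → ℝ} (hv : ContinuousOn v (Icc a b))
    (hv' : ∀ x ∈ Ico a b, HasDerivWithinAt v (v' x) (Ici x) x)
    (hsup : ∀ x ∈ Ico a b, pruferField P Q x (v x) ≤ v' x) (ha : θ a ≤ v a) :
    ∀ x ∈ Icc a b, θ x ≤ v x := by
  obtain ⟨K, -, hK⟩ := exists_bound_on_Icc (hQ.sub hP) a b
  exact le_of_subsolution_of_supersolution (F := pruferField P Q) (K := K)
    (fun x hx u v => (abs_pruferField_sub_le P Q x u v).trans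
      (mul_le_mul_of_nonneg_right (hK x ⟨hx.1, hx.2.le⟩) (abs_nonneg _)))
    h.continuous.continuousOn hv (fun x _ => (h x).hasDerivWithinAt) hv' (fun x _ => le_rfl)
    hsup ha

lemma IsPruferAngle.ge_of_subsolution {P Q θ : ℝ → ℝ} (hP : Continuous P) (hQ : Continuous Q)
    (h : IsPruferAngle P Q θ) {a b : ℝ} {v v' : ℝ → ℝ} (hv : ContinuousOn v (Icc a b))
    (hv' : ∀ x ∈ Ico a b, HasDerivWithinAt v (v' x) (Ici x) x)
    (hsub : ∀ x ∈ Ico a b, v' x ≤ pruferField P Q x (v x)) (ha : v a ≤ θ a) :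
    ∀ x ∈ Icc a b, v x ≤ θ x := by
  obtain ⟨K, -, hK⟩ := exists_bound_on_Icc (hQ.sub hP) a b
  exact le_of_subsolution_of_supersolution (F := pruferField P Q) (K := K)
    (fun x hx u v => (abs_pruferField_sub_le P Q x u v).trans
      (mul_le_mul_of_nonneg_right (hK x ⟨hx.1, hx.2.le⟩) (abs_nonneg _)))
    hv h.continuous.continuousOn hv' (fun x _ => (h x).hasDerivWithinAt) hsub (fun x _ => le_rfl)
    ha

/-- Sturm comparison for Prüfer angles. -/
lemma IsPruferAngle.le_of_le {P Q R θ ψ : ℝ → ℝ} (hP : Continuous P) (hQ : Continuous Q)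
    (h : IsPruferAngle P Q θ) (h' : IsPruferAngle P R ψ) {a b : ℝ}
    (hQR : ∀ x ∈ Ico a b, Q x ≤ R x) (ha : θ a ≤ ψ a) : ∀ x ∈ Icc a b, θ x ≤ ψ x :=
  h.le_of_supersolution hP hQ h'.continuous.continuousOn (fun x _ => (h' x).hasDerivWithinAt)
    (fun x hx => by
      unfold pruferField
      have := mul_le_mul_of_nonneg_right (hQR x hx) (sq_nonneg (Real.sin (ψ x)))
      linarith) ha

/-- Existence of global Prüfer angles. -/
theorem exists_isPruferAngle {P Q : ℝ → ℝ} (hP : Continuous P) (hQ : Continuous Q) (θ₀ : ℝ) :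
    ∃ θ, θ 0 = θ₀ ∧ IsPruferAngle P Q θ := by
  have hloc : ∀ n : ℕ, ∃ α : ℝ → ℝ, α 0 = θ₀ ∧
      ∀ x ∈ Ioo (-((n : ℝ) + 1)) ((n : ℝ) + 1), HasDerivAt α (pruferField P Q x (α x)) x := by
    intro n
    obtain ⟨K, hK0, hK⟩ := exists_bound_on_Icc (hQ.sub hP) (-((n : ℝ) + 1)) (n + 1)
    obtain ⟨M, hM0, hM⟩ := exists_bound_on_Icc (hP.abs.add hQ.abs) (-((n : ℝ) + 1)) (n + 1)
    have hn : (0 : ℝ) < n + 1 := by positivity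
    let t₀ : Icc (-((n : ℝ) + 1)) ((n : ℝ) + 1) := ⟨0, by constructor <;> linarith⟩
    -- The field is bounded by M independently of the angle, so a ball of radius M(n + 1) contains
    -- the solution on the whole interval and no shrinking in time is needed.
    have hPL : IsPicardLindelof (pruferField P Q) t₀ θ₀ (Real.toNNReal (M * (n + 1))) 0
        (Real.toNNReal M) (Real.toNNReal K) := by
      refine ⟨fun t ht => ?_, fun v _ => ?_, fun t ht v _ => ?_, ?_⟩
      · refine LipschitzOnWith.of_dist_le_mul fun u _ v _ => ?_
        rw [Real.dist_eq, Real.dist_eq, Real.coe_toNNReal _ hK0]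
        exact (abs_pruferField_sub_le P Q t u v).trans
          (mul_le_mul_of_nonneg_right (hK t ht) (abs_nonneg _))
      · unfold pruferField
        fun_prop
      · rw [Real.norm_eq_abs, Real.coe_toNNReal _ hM0]
        exact (abs_pruferField_le P Q t v).trans ((le_abs_self _).trans (hM t ht))
      · rw [Real.coe_toNNReal _ hM0, Real.coe_toNNReal _ (by positivity)]
        simp [t₀]
    obtain ⟨α, hα0, hα⟩ := hPL.exists_eq_forall_mem_Icc_hasDerivWithinAt₀
    exact ⟨α, hα0, fun x hx => (hα x ⟨hx.1.le, hx.2.le⟩).hasDerivAt (Icc_mem_nhds hx.1 hx.2)⟩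
  choose α hα0 hα using hloc
  have hagree : ∀ n m : ℕ, n ≤ m → ∀ x, |x| < (n : ℝ) + 1 → α n x = α m x := by
    intro n m hnm x hx
    have hn : (0 : ℝ) < n + 1 := by positivity
    have hnm' : (n : ℝ) ≤ m := by exact_mod_cast hnm
    obtain ⟨K, hK0, hK⟩ := exists_bound_on_Icc (hQ.sub hP) (-((n : ℝ) + 1)) (n + 1)
    refine ODE_solution_unique_of_mem_Ioo (v := pruferField P Q) (s := fun _ => univ)
      (K := Real.toNNReal K) (a := -((n : ℝ) + 1)) (b := n + 1) (t₀ := 0)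
      (fun t ht => LipschitzOnWith.of_dist_le_mul fun u _ v _ => ?_) ⟨by linarith, hn⟩
      (fun t ht => ⟨hα n t ht, trivial⟩)
      (fun t ht => ⟨hα m t ⟨by linarith [ht.1], by linarith [ht.2]⟩, trivial⟩)
      (by rw [hα0, hα0]) (abs_lt.1 hx)
    rw [Real.dist_eq, Real.dist_eq, Real.coe_toNNReal _ hK0]
    exact (abs_pruferField_sub_le P Q t u v).trans
      (mul_le_mul_of_nonneg_right (hK t ⟨ht.1.le, ht.2.le⟩) (abs_nonneg _))
  have hceil : ∀ x : ℝ, |x| < (⌈|x|⌉₊ : ℝ) + 1 := fun x => by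
    linarith [Nat.le_ceil |x|]
  -- Glueing by the index ⌈|x|⌉: near x all indices involved are at most ⌈|x|⌉ + 1, and that single
  -- local solution agrees with each of them.
  refine ⟨fun x => α ⌈|x|⌉₊ x, by simp [hα0], fun x => ?_⟩
  have hev : (fun y => α ⌈|y|⌉₊ y) =ᶠ[𝓝 x] α (⌈|x|⌉₊ + 1) := by
    have hlt : |x| < (⌈|x|⌉₊ : ℝ) + 1 := hceil x
    filter_upwards [(continuous_abs.tendsto x).eventually (gt_mem_nhds hlt)] with y hy
    refine hagree _ _ ?_ y (hceil y)
    exact Nat.ceil_le.2 (by push_cast; exact hy.le)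
  have hx : x ∈ Ioo (-(((⌈|x|⌉₊ + 1 : ℕ) : ℝ) + 1)) (((⌈|x|⌉₊ + 1 : ℕ) : ℝ) + 1) := by
    push_cast
    exact abs_lt.1 (by linarith [hceil x])
  have := (hα _ x hx).congr_of_eventuallyEq hev
  rwa [← hev.eq_of_nhds] at this

lemma sin_int_mul_pi_sq (m : ℤ) : Real.sin (m * π) ^ 2 = 0 := by simp [Real.sin_int_mul_pi]

lemma cos_int_mul_pi_sq (m : ℤ) : Real.cos (m * π) ^ 2 = 1 := by
  rw [Real.cos_sq', sin_int_mul_pi_sq, sub_zero]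

/-- A Prüfer angle crosses multiples of `π` only upwards. -/
lemma IsPruferAngle.int_mul_pi_lt {P Q θ : ℝ → ℝ} (hP : Continuous P) (hQ : Continuous Q)
    (h : IsPruferAngle P Q θ) (hpos : ∀ x, 0 < P x) {m : ℤ} {a x : ℝ} (ha : m * π ≤ θ a)
    (hax : a < x) : m * π < θ x := by
  have hge : ∀ y ∈ Icc a x, m * π ≤ θ y :=
    h.ge_of_subsolution (v := fun _ => m * π) (v' := fun _ => 0) hP hQ continuousOn_const
      (fun _ _ => hasDerivWithinAt_const _ _ _)
      (fun y _ => by simp [pruferField, cos_int_mul_pi_sq, (hpos y).le]) ha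
  refine lt_of_le_of_ne (hge x ⟨hax.le, le_rfl⟩) fun heq => ?_
  have hd := h x
  have hd' : pruferField P Q x (θ x) = P x := by
    rw [← heq]
    simp [pruferField, cos_int_mul_pi_sq]
  rw [hd'] at hd
  -- Equality at the right endpoint would make it a minimum of θ on [a, x], forcing a nonpositive
  -- derivative, whereas θ' = P > 0 at a multiple of π.
  have hmin : IsMinOn θ (Icc a x) x := fun y hy => by
    change θ x ≤ θ y; rw [← heq]; exact hge y hy
  have hslope : Tendsto (slope θ x) (𝓝[<] x) (𝓝 (P x)) :=
    (hasDerivAt_iff_tendsto_slope.1 hd).mono_left (nhdsWithin_mono _ fun y hy => ne_of_lt hy)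
  have : P x ≤ 0 := by
    refine le_of_tendsto hslope ?_
    filter_upwards [Ioo_mem_nhdsLT hax] with y hy
    rw [slope_def_field]
    exact div_nonpos_of_nonneg_of_nonpos (sub_nonneg.2 (hmin ⟨hy.1.le, hy.2.le⟩))
      (sub_nonpos.2 hy.2.le)
  linarith [hpos x]

/-- Continuous dependence of Prüfer angles on the coefficient `Q`. -/
lemma IsPruferAngle.abs_sub_le {P Q R θ ψ : ℝ → ℝ} (h : IsPruferAngle P Q θ)
    (h' : IsPruferAngle P R ψ) {a b K ε : ℝ} (hK : ∀ x ∈ Ico a b, |Q x - P x| ≤ K)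
    (hε : ∀ x ∈ Ico a b, |Q x - R x| ≤ ε) (ha : θ a = ψ a) :
    ∀ x ∈ Icc a b, |θ x - ψ x| ≤ gronwallBound 0 K ε (x - a) := by
  refine norm_le_gronwallBound_of_norm_deriv_right_le (E := ℝ) (f := fun x => θ x - ψ x)
    (h.continuous.sub h'.continuous).continuousOn
    (fun x _ => ((h x).sub (h' x)).hasDerivWithinAt) (by simp [ha]) fun x hx => ?_
  have h1 : pruferField P Q x (θ x) - pruferField P R x (ψ x)
      = (pruferField P Q x (θ x) - pruferField P Q x (ψ x))
        + (Q x - R x) * Real.sin (ψ x) ^ 2 := by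
    unfold pruferField; ring
  rw [h1, Real.norm_eq_abs, Real.norm_eq_abs]
  refine (abs_add_le _ _).trans (add_le_add ?_ ?_)
  · exact (abs_pruferField_sub_le P Q x _ _).trans
      (mul_le_mul_of_nonneg_right (hK x hx) (abs_nonneg _))
  · rw [abs_mul, abs_of_nonneg (sq_nonneg (Real.sin (ψ x)))]
    exact (mul_le_of_le_one_right (abs_nonneg _) (Real.sin_sq_le_one _)).trans (hε x hx)

/-- Strict Sturm comparison for Prüfer angles. -/
lemma IsPruferAngle.lt_of_lt {P Q R θ ψ : ℝ → ℝ} (hP : Continuous P) (hQ : Continuous Q)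
    (h : IsPruferAngle P Q θ) (h' : IsPruferAngle P R ψ) (hpos : ∀ x, 0 < P x) {a b : ℝ}
    (hab : a < b) (hQR : ∀ x, Q x < R x) (ha : θ a ≤ ψ a) : θ b < ψ b := by
  have hle : ∀ x ∈ Icc a b, θ x ≤ ψ x := h.le_of_le hP hQ h' (fun x _ => (hQR x).le) ha
  obtain ⟨K, hK0, hK⟩ := exists_bound_on_Icc (hQ.sub hP) a b
  refine lt_of_le_of_ne (hle b ⟨hab.le, le_rfl⟩) fun heq => ?_
  -- The factor exp(K x) absorbs the Lipschitz loss, making the weighted gap nondecreasing; if it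
  -- vanishes at b it vanishes on all of [a, b].
  have hd : ∀ x, HasDerivAt (fun x => Real.exp (K * x) * (ψ x - θ x))
      (Real.exp (K * x) * (K * (ψ x - θ x)
        + (pruferField P R x (ψ x) - pruferField P Q x (θ x)))) x := by
    intro x
    have h1 : HasDerivAt (fun x : ℝ => K * x) K x := by
      simpa using (hasDerivAt_id x).const_mul K
    convert! h1.exp.mul ((h' x).sub (h x)) using 1
    simp only [Pi.sub_apply]
    ring
  have hmono : MonotoneOn (fun x => Real.exp (K * x) * (ψ x - θ x)) (Icc a b) := by
    refine monotoneOn_of_hasDerivWithinAt_nonneg (convex_Icc a b)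
      (fun x _ => (hd x).continuousAt.continuousWithinAt)
      (fun x _ => (hd x).hasDerivWithinAt) fun x hx => ?_
    rw [interior_Icc] at hx
    have hx' : x ∈ Icc a b := ⟨hx.1.le, hx.2.le⟩
    have h1 := abs_pruferField_sub_le P Q x (ψ x) (θ x)
    rw [abs_of_nonneg (sub_nonneg.2 (hle x hx'))] at h1
    have h2 : |Q x - P x| * (ψ x - θ x) ≤ K * (ψ x - θ x) :=
      mul_le_mul_of_nonneg_right (hK x hx') (sub_nonneg.2 (hle x hx'))
    have h3 := neg_le_of_abs_le (h1.trans h2)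
    have h4 : pruferField P Q x (ψ x) ≤ pruferField P R x (ψ x) := by
      unfold pruferField
      have := mul_le_mul_of_nonneg_right (hQR x).le (sq_nonneg (Real.sin (ψ x)))
      linarith
    have := Real.exp_pos (K * x)
    apply mul_nonneg this.le
    linarith
  have hEq : ∀ x ∈ Icc a b, ψ x = θ x := by
    intro x hx
    have h1 := hmono hx ⟨hab.le, le_rfl⟩ hx.2
    simp only [heq, sub_self, mul_zero] at h1
    have h2 := (mul_nonpos_iff.1 h1).resolve_right
      (fun h => absurd h.1 (not_le.2 (Real.exp_pos _)))
    linarith [h2.2, hle x hx]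
  -- Coinciding angles give (R - Q) sin² θ = 0. But sin θ cannot vanish on an interval, since its
  -- derivative there would be ±P ≠ 0.
  have hsin : ∀ x ∈ Ioo a b, Real.sin (θ x) = 0 := by
    intro x hx
    have hev : ψ =ᶠ[𝓝 x] θ := by
      filter_upwards [Ioo_mem_nhds hx.1 hx.2] with y hy using hEq y ⟨hy.1.le, hy.2.le⟩
    have h1 := (h' x).unique ((h x).congr_of_eventuallyEq hev)
    rw [hev.eq_of_nhds] at h1
    unfold pruferField at h1
    have h2 : (R x - Q x) * Real.sin (θ x) ^ 2 = 0 := by linarith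
    rcases mul_eq_zero.1 h2 with h3 | h3
    · linarith [hQR x]
    · exact pow_eq_zero_iff two_ne_zero |>.1 h3
  obtain ⟨c, hc⟩ : (Ioo a b).Nonempty := nonempty_Ioo.2 hab
  have h1 : HasDerivAt (fun x => Real.sin (θ x)) 0 c := by
    refine (hasDerivAt_const c (0 : ℝ)).congr_of_eventuallyEq ?_
    filter_upwards [Ioo_mem_nhds hc.1 hc.2] with y hy using hsin y hy
  have h2 := h1.unique (h c).sin
  have hs := hsin c hc
  have hcos : Real.cos (θ c) ^ 2 = 1 := by rw [Real.cos_sq', hs]; norm_num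
  simp only [pruferField, hs, hcos] at h2
  have hcos' : Real.cos (θ c) ≠ 0 := fun h0 => by simp [h0] at hcos
  have := hpos c
  simp [hcos', this.ne'] at h2

/-- The Prüfer angle is the phase of any solution with the same initial phase. -/
lemma IsPruferAngle.phase_eq {E : Type*} [NormedAddCommGroup E] [NormedSpace ℝ E]
    {P Q θ : ℝ → ℝ} (hP : Continuous P) (hQ : Continuous Q)
    (h : IsPruferAngle P Q θ) {u z : ℝ → E} (hu : ∀ x, HasDerivAt u (P x • z x) x)
    (hz : ∀ x, HasDerivAt z (-(Q x • u x)) x) {a : ℝ}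
    (ha : Real.cos (θ a) • u a = Real.sin (θ a) • z a) {x : ℝ} (hx : a ≤ x) :
    Real.cos (θ x) • u x = Real.sin (θ x) • z x := by
  obtain ⟨K, hK0, hK⟩ := exists_bound_on_Icc (hQ.sub hP) a x
  -- The phase defect solves a homogeneous linear first order equation, so it stays zero once it is
  -- zero.
  have hd : ∀ x, HasDerivAt (fun x => Real.cos (θ x) • u x - Real.sin (θ x) • z x)
      (((Q x - P x) * (Real.sin (θ x) * Real.cos (θ x))) •
        (Real.cos (θ x) • u x - Real.sin (θ x) • z x)) x := by
    intro x
    convert! ((h x).cos.smul (hu x)).sub ((h x).sin.smul (hz x)) using 1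
    rw [pruferField_eq]
    have hc := Real.cos_sq' (θ x)
    have e1 : Real.cos (θ x) * P x - Real.cos (θ x) * (P x + (Q x - P x) * Real.sin (θ x) ^ 2)
      = -((Q x - P x) * (Real.sin (θ x) * Real.cos (θ x)) * Real.sin (θ x)) := by ring
    have e2 : -(Real.sin (θ x) * (P x + (Q x - P x) * Real.sin (θ x) ^ 2))
        + Real.sin (θ x) * Q x
      = (Q x - P x) * (Real.sin (θ x) * Real.cos (θ x)) * Real.cos (θ x) := by
      have : (Q x - P x) * (Real.sin (θ x) * Real.cos (θ x)) * Real.cos (θ x)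
        = (Q x - P x) * Real.sin (θ x) * Real.cos (θ x) ^ 2 := by ring
      rw [this, hc]; ring
    have e3 : ∀ (A B C D : ℝ) (U Z : E), A • P x • Z + B • U - (C • -(Q x • U) + D • Z)
        = (A * P x - D) • Z + (B + C * Q x) • U := by intros; module
    rw [e3, smul_sub, smul_smul, smul_smul, ← e2, sub_eq_add_neg, ← neg_smul, ← e1]
    module
  have := eq_zero_of_abs_deriv_le_mul_abs_self_of_eq_zero_right (K := K)
    (fun y _ => (hd y).continuousAt.continuousWithinAt)
    (fun y _ => (hd y).hasDerivWithinAt) (sub_eq_zero.2 ha) (fun y hy => ?_) x ⟨hx, le_rfl⟩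
  · exact sub_eq_zero.1 this
  · rw [norm_smul, Real.norm_eq_abs, abs_mul]
    refine mul_le_mul_of_nonneg_right ?_ (norm_nonneg _)
    have h1 : |Real.sin (θ y) * Real.cos (θ y)| ≤ 1 := by
      rw [abs_mul]
      exact mul_le_one₀ (Real.abs_sin_le_one _) (abs_nonneg _) (Real.abs_cos_le_one _)
    exact (mul_le_of_le_one_right (abs_nonneg _) h1).trans (hK y ⟨hy.1, hy.2.le⟩)

section

/-! ### The Prüfer angle of the Mathieu equation -/

lemma exists_int_of_sin_eq_zero {v : ℝ} (h : Real.sin v = 0) : ∃ n : ℤ, v = n * π := by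
  obtain ⟨n, hn⟩ := Real.sin_eq_zero_iff.1 h
  exact ⟨n, hn.symm⟩

lemma add_one_mul_pi_le {v : ℝ} {m : ℤ} (h : Real.sin v = 0) (hm : m * π < v) :
    ((m : ℝ) + 1) * π ≤ v := by
  obtain ⟨n, rfl⟩ := exists_int_of_sin_eq_zero h
  have h1 : (m : ℝ) < n := lt_of_mul_lt_mul_right hm Real.pi_pos.le
  have h2 : m + 1 ≤ n := by exact_mod_cast h1
  have h3 : (m : ℝ) + 1 ≤ n := by exact_mod_cast h2
  exact mul_le_mul_of_nonneg_right h3 Real.pi_pos.le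

/-- The coefficient `(λ - q sin² x) / κ` of the Mathieu equation `u' = κ z`,
`z' = -κ⁻¹ (λ - q sin² x) u`. -/
noncomputable def mathieuCoeff (κ lam q x : ℝ) : ℝ := (lam - q * Real.sin x ^ 2) / κ

lemma continuous_mathieuCoeff (κ lam q : ℝ) : Continuous (mathieuCoeff κ lam q) := by
  unfold mathieuCoeff
  fun_prop

/-- The initial phase for the parity `i`. -/
noncomputable def startAngle (i : Fin 2) : ℝ := if i = 0 then π / 2 else 0

/-- The phase at `π / 2` of the `k`-th eigenfunction of the class `(i, j)`. -/
noncomputable def targetAngle (i j : Fin 2) (k : ℕ) : ℝ :=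
  if i = j then k * π + π / 2 else (k + 1) * π

/-- The boundary condition at `π / 2` of the class `(i, j)`, in terms of the phase. -/
def BoundaryPhase (i j : Fin 2) (v : ℝ) : Prop :=
  if i = j then Real.cos v = 0 else Real.sin v = 0

lemma exists_mathieuAngle (κ : ℝ) (i : Fin 2) (lam q : ℝ) :
    ∃ θ, θ 0 = startAngle i ∧ IsPruferAngle (fun _ => κ) (mathieuCoeff κ lam q) θ :=
  exists_isPruferAngle continuous_const (continuous_mathieuCoeff κ lam q) _

/-- The Prüfer angle, with weight `κ`, of the solution of parity `i` of the Mathieu equation. -/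
noncomputable def mathieuAngle (κ : ℝ) (i : Fin 2) (lam q : ℝ) : ℝ → ℝ :=
  (exists_mathieuAngle κ i lam q).choose

section Angle

variable (κ : ℝ) (i : Fin 2) (lam q : ℝ)

@[simp] lemma mathieuAngle_zero : mathieuAngle κ i lam q 0 = startAngle i :=
  (exists_mathieuAngle κ i lam q).choose_spec.1

lemma isPruferAngle_mathieuAngle :
    IsPruferAngle (fun _ => κ) (mathieuCoeff κ lam q) (mathieuAngle κ i lam q) :=
  (exists_mathieuAngle κ i lam q).choose_spec.2

lemma startAngle_nonneg : 0 ≤ startAngle i := by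
  unfold startAngle
  split_ifs <;> positivity

lemma startAngle_le : startAngle i ≤ π / 2 := by
  unfold startAngle
  split_ifs
  · exact le_rfl
  · positivity

lemma startAngle_lt_pi : startAngle i < π := by
  linarith [startAngle_le i, Real.pi_pos]

end Angle

variable {κ : ℝ} {i : Fin 2}

lemma mathieuAngle_pos (hκ : 0 < κ) (lam q : ℝ) {x : ℝ} (hx : 0 < x) :
    0 < mathieuAngle κ i lam q x := by
  have := (isPruferAngle_mathieuAngle κ i lam q).int_mul_pi_lt (m := 0) (a := 0) continuous_const
    (continuous_mathieuCoeff κ lam q) (fun _ => hκ) (by simpa using startAngle_nonneg i) hx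
  simpa using this

lemma mathieuAngle_strictMono (hκ : 0 < κ) (q : ℝ) {x : ℝ} (hx : 0 < x) :
    StrictMono (fun lam => mathieuAngle κ i lam q x) := by
  intro l₁ l₂ hl
  refine (isPruferAngle_mathieuAngle κ i l₁ q).lt_of_lt continuous_const
    (continuous_mathieuCoeff κ l₁ q) (isPruferAngle_mathieuAngle κ i l₂ q) (fun _ => hκ) hx
    (fun y => ?_) (by simp)
  unfold mathieuCoeff
  gcongr

lemma continuous_mathieuAngle_params (κ : ℝ) (i : Fin 2) {x : ℝ} (hx : 0 ≤ x) :
    Continuous (fun p : ℝ × ℝ => mathieuAngle κ i p.1 p.2 x) := by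
  refine continuous_iff_continuousAt.2 fun p => ?_
  obtain ⟨K, hK0, hK⟩ := exists_bound_on_Icc
    ((continuous_mathieuCoeff κ p.1 p.2).sub (continuous_const (y := κ))) 0 x
  refine tendsto_iff_dist_tendsto_zero.2 ?_
  have hlim : Tendsto (fun r : ℝ × ℝ => gronwallBound 0 K ((|p.1 - r.1| + |p.2 - r.2|) / |κ|)
      (x - 0)) (𝓝 p) (𝓝 0) := by
    have h1 : Continuous (fun r : ℝ × ℝ => gronwallBound 0 K
        ((|p.1 - r.1| + |p.2 - r.2|) / |κ|) (x - 0)) :=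
      (gronwallBound_continuous_ε 0 K (x - 0)).comp (by fun_prop)
    have := h1.tendsto p
    simpa [gronwallBound_ε0_δ0] using this
  refine squeeze_zero (fun _ => dist_nonneg) (fun r => ?_) hlim
  rw [dist_comm, Real.dist_eq]
  refine (isPruferAngle_mathieuAngle κ i p.1 p.2).abs_sub_le
    (isPruferAngle_mathieuAngle κ i r.1 r.2) (fun y hy => hK y ⟨hy.1, hy.2.le⟩)
    (fun y _ => ?_) (by simp) x ⟨hx, le_rfl⟩
  unfold mathieuCoeff
  rw [← sub_div, abs_div]
  gcongr
  have : p.1 - p.2 * Real.sin y ^ 2 - (r.1 - r.2 * Real.sin y ^ 2)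
      = (p.1 - r.1) - (p.2 - r.2) * Real.sin y ^ 2 := by ring
  rw [this]
  refine (abs_sub _ _).trans (add_le_add le_rfl ?_)
  rw [abs_mul, abs_of_nonneg (sq_nonneg (Real.sin y))]
  exact mul_le_of_le_one_right (abs_nonneg _) (Real.sin_sq_le_one _)

/-- With constant coefficients the angle has passed `(k + 1) π` at the `(k + 1)`-st zero. -/
lemma IsPruferAngle.ge_of_const {κ m : ℝ} (hκ : 0 < κ) (hm : 0 < m) {θ : ℝ → ℝ}
    (h : IsPruferAngle (fun _ => κ) (fun _ => κ * m ^ 2) θ) (h0 : θ 0 = startAngle i) (k : ℕ) :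
    (k + 1) * π ≤ θ (((k + 1) * π - startAngle i) / (m * κ)) := by
  have hmk : 0 < m * κ := by positivity
  set φ := startAngle i with hφ
  have hlin : ∀ x, HasDerivAt (fun x : ℝ => m * κ * x + φ) (m * κ) x := fun x => by
    simpa using ((hasDerivAt_id x).const_mul (m * κ)).add_const φ
  have hphase : ∀ x, 0 ≤ x → Real.cos (θ x) • Real.sin (m * κ * x + φ)
      = Real.sin (θ x) • (m * Real.cos (m * κ * x + φ)) := by
    intro x hx
    refine h.phase_eq continuous_const continuous_const
      (u := fun x => Real.sin (m * κ * x + φ)) (z := fun x => m * Real.cos (m * κ * x + φ))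
      (fun x => ?_) (fun x => ?_) (a := 0) ?_ hx
    · convert! (hlin x).sin using 1
      simp only [smul_eq_mul]; ring
    · convert! (hlin x).cos.const_mul m using 1
      simp only [smul_eq_mul]; ring
    -- The explicit solution has amplitudes 1 and m, so its initial phase matches only because φ is
    -- 0 or π/2.
    · rw [h0, mul_zero, zero_add, hφ]
      unfold startAngle
      split_ifs <;> simp
  have hzero : ∀ j : ℕ, Real.sin (θ (((j + 1) * π - φ) / (m * κ))) = 0 := by
    intro j
    have hx : 0 ≤ (((j : ℝ) + 1) * π - φ) / (m * κ) := by
      refine div_nonneg ?_ hmk.le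
      have : (0 : ℝ) ≤ j * π := by positivity
      have := startAngle_lt_pi i
      linarith
    have h1 := hphase _ hx
    have h2 : m * κ * ((((j : ℝ) + 1) * π - φ) / (m * κ)) + φ = ((j + 1 : ℕ) : ℝ) * π := by
      rw [mul_div_cancel₀ _ hmk.ne']
      push_cast; ring
    rw [h2, Real.sin_nat_mul_pi, Real.cos_nat_mul_pi] at h1
    simp only [smul_eq_mul, mul_zero] at h1
    rcases mul_eq_zero.1 h1.symm with h3 | h3
    · exact h3
    · exact absurd h3 (mul_ne_zero hm.ne' (pow_ne_zero _ (by norm_num)))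
  induction k with
  | zero =>
    have h1 := add_one_mul_pi_le (m := 0) (hzero 0) (h.int_mul_pi_lt continuous_const
      continuous_const (fun _ => hκ) (a := 0) (by simpa [h0] using startAngle_nonneg i) ?_)
    · simpa using h1
    · simp only [Nat.cast_zero, zero_add, one_mul]
      exact div_pos (by linarith [startAngle_lt_pi i]) hmk
  | succ k ih =>
    have h1 := add_one_mul_pi_le (m := (k + 1 : ℕ)) (hzero (k + 1)) (h.int_mul_pi_lt
      continuous_const continuous_const (fun _ => hκ)
      (a := (((k : ℝ) + 1) * π - φ) / (m * κ)) (by push_cast; exact ih) ?_)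
    · exact_mod_cast h1
    · push_cast
      gcongr
      linarith

lemma IsPruferAngle.int_mul_pi_le {P Q θ : ℝ → ℝ} (hP : Continuous P) (hQ : Continuous Q)
    (h : IsPruferAngle P Q θ) (hpos : ∀ x, 0 < P x) {m : ℤ} {a x : ℝ} (ha : m * π ≤ θ a)
    (hax : a ≤ x) : m * π ≤ θ x := by
  rcases hax.eq_or_lt with rfl | hlt
  · exact ha
  · exact (h.int_mul_pi_lt hP hQ hpos ha hlt).le

/-- Comparison with constant coefficients: m κ = 2(k + 1) is a frequency at which the (k + 1)-st
zero falls no later than π/2, and λ = κ² m² + |q| makes the Mathieu coefficient at least κ m². -/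
lemma exists_le_mathieuAngle (hκ : 0 < κ) (i : Fin 2) (q : ℝ) (k : ℕ) :
    ∃ lam, (k + 1) * π ≤ mathieuAngle κ i lam q (π / 2) := by
  set m : ℝ := 2 * (k + 1) / κ with hm
  have hm0 : 0 < m := by positivity
  obtain ⟨θ, h0, hθ⟩ := exists_isPruferAngle (P := fun _ => κ) (Q := fun _ => κ * m ^ 2)
    continuous_const continuous_const (startAngle i)
  refine ⟨κ ^ 2 * m ^ 2 + |q|, ?_⟩
  have h1 := hθ.ge_of_const hκ hm0 h0 k
  have hx : (((k : ℝ) + 1) * π - startAngle i) / (m * κ) ≤ π / 2 := by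
    rw [hm, div_mul_cancel₀ _ hκ.ne', div_le_iff₀ (by positivity)]
    have := startAngle_nonneg i
    nlinarith
  have h2 := hθ.int_mul_pi_le (m := (k + 1 : ℕ)) continuous_const continuous_const (fun _ => hκ)
    (by push_cast; exact h1) hx
  refine le_trans (by push_cast at h2; exact h2) ?_
  refine hθ.le_of_le continuous_const continuous_const (isPruferAngle_mathieuAngle κ i _ q)
    (a := 0) (b := π / 2) (fun x _ => ?_) (by simp [h0]) _ ⟨by positivity, le_rfl⟩
  unfold mathieuCoeff
  rw [le_div_iff₀ hκ]
  have h3 : q * Real.sin x ^ 2 ≤ |q| :=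
    (mul_le_mul_of_nonneg_right (le_abs_self q) (sq_nonneg _)).trans
      (mul_le_of_le_one_right (abs_nonneg _) (Real.sin_sq_le_one _))
  nlinarith

/-- At λ = -|q| the coefficient is nonpositive, so the constant π/2 is a supersolution. -/
lemma exists_mathieuAngle_le (hκ : 0 < κ) (i : Fin 2) (q : ℝ) :
    ∃ lam, mathieuAngle κ i lam q (π / 2) ≤ π / 2 := by
  refine ⟨-|q|, ?_⟩
  refine (isPruferAngle_mathieuAngle κ i (-|q|) q).le_of_supersolution continuous_const
    (continuous_mathieuCoeff κ _ q) (a := 0) (b := π / 2) (v := fun _ => π / 2)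
    (v' := fun _ => 0) continuousOn_const (fun _ _ => hasDerivWithinAt_const _ _ _)
    (fun x _ => ?_) (by simpa using startAngle_le i) _ ⟨by positivity, le_rfl⟩
  simp only [pruferField, Real.cos_pi_div_two, Real.sin_pi_div_two, mathieuCoeff]
  have h3 : -(q * Real.sin x ^ 2) ≤ |q| := by
    rw [← neg_mul]
    exact (mul_le_mul_of_nonneg_right (neg_le_abs q) (sq_nonneg _)).trans
      (mul_le_of_le_one_right (abs_nonneg _) (Real.sin_sq_le_one _))
  have : (-|q| - q * Real.sin x ^ 2) / κ ≤ 0 := div_nonpos_of_nonpos_of_nonneg (by linarith) hκ.le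
  simpa using this

lemma targetAngle_le (i j : Fin 2) (k : ℕ) : targetAngle i j k ≤ (k + 1) * π := by
  unfold targetAngle
  split_ifs
  · linarith [Real.pi_pos]
  · exact le_rfl

lemma le_targetAngle (i j : Fin 2) (k : ℕ) : k * π + π / 2 ≤ targetAngle i j k := by
  unfold targetAngle
  split_ifs
  · exact le_rfl
  · linarith [Real.pi_pos]

lemma targetAngle_strictMono (i j : Fin 2) : StrictMono (targetAngle i j) := by
  intro a b hab
  have : (a : ℝ) + 1 ≤ b := by exact_mod_cast hab
  have := mul_le_mul_of_nonneg_right this Real.pi_pos.le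
  unfold targetAngle
  have := Real.pi_pos
  split_ifs <;> linarith

/-- Positivity of the phase excludes all smaller solutions of the boundary condition, so that the
numbering starts at k = 0. -/
lemma boundaryPhase_iff {i j : Fin 2} {v : ℝ} (hv : 0 < v) :
    BoundaryPhase i j v ↔ ∃ k : ℕ, v = targetAngle i j k := by
  unfold BoundaryPhase targetAngle
  split_ifs
  · rw [Real.cos_eq_zero_iff]
    constructor
    · rintro ⟨n, rfl⟩
      have h1 : (0 : ℝ) < 2 * n + 1 := by
        by_contra! h
        have := mul_nonpos_of_nonpos_of_nonneg h Real.pi_pos.le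
        linarith
      have h2 : (0 : ℤ) < 2 * n + 1 := by exact_mod_cast h1
      obtain ⟨k, rfl⟩ := Int.eq_ofNat_of_zero_le (show 0 ≤ n by omega)
      exact ⟨k, by push_cast; ring⟩
    · rintro ⟨k, rfl⟩
      exact ⟨k, by push_cast; ring⟩
  · constructor
    · intro h
      obtain ⟨n, rfl⟩ := exists_int_of_sin_eq_zero h
      have h1 : (0 : ℝ) < n := pos_of_mul_pos_left hv Real.pi_pos.le
      have h2 : (0 : ℤ) < n := by exact_mod_cast h1
      obtain ⟨k, hk⟩ := Int.eq_ofNat_of_zero_le (show 0 ≤ n - 1 by omega)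
      refine ⟨k, ?_⟩
      have : (n : ℝ) - 1 = k := by exact_mod_cast hk
      rw [← this]; ring
    · rintro ⟨k, rfl⟩
      exact_mod_cast Real.sin_nat_mul_pi (k + 1)

lemma exists_mathieuAngle_eq_target (hκ : 0 < κ) (i j : Fin 2) (k : ℕ) (q : ℝ) :
    ∃ lam, mathieuAngle κ i lam q (π / 2) = targetAngle i j k := by
  obtain ⟨l₁, h₁⟩ := exists_mathieuAngle_le hκ i q
  obtain ⟨l₂, h₂⟩ := exists_le_mathieuAngle hκ i q k
  have hc : Continuous (fun lam => mathieuAngle κ i lam q (π / 2)) :=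
    (continuous_mathieuAngle_params κ i (by positivity : (0 : ℝ) ≤ π / 2)).comp
      (continuous_id.prodMk continuous_const)
  have h3 : (0 : ℝ) ≤ k * π := by positivity
  exact mem_range_of_exists_le_of_exists_ge hc
    ⟨l₁, h₁.trans (le_trans (by linarith) (le_targetAngle i j k))⟩
    ⟨l₂, (targetAngle_le i j k).trans h₂⟩

/-- The `k`-th value of `λ` for which the Mathieu equation has a solution in the class `(i, j)`. -/
noncomputable def level (i j : Fin 2) (k : ℕ) (q : ℝ) : ℝ :=
  (exists_mathieuAngle_eq_target one_pos i j k q).choose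

lemma mathieuAngle_one_level (i j : Fin 2) (k : ℕ) (q : ℝ) :
    mathieuAngle 1 i (level i j k q) q (π / 2) = targetAngle i j k :=
  (exists_mathieuAngle_eq_target one_pos i j k q).choose_spec

lemma level_strictMono (i j : Fin 2) (q : ℝ) : StrictMono (fun k => level i j k q) := by
  intro a b hab
  refine (mathieuAngle_strictMono (i := i) one_pos q Real.pi_div_two_pos).lt_iff_lt.1 ?_
  simp only [mathieuAngle_one_level]
  exact targetAngle_strictMono i j hab

lemma range_level (i j : Fin 2) (q : ℝ) :
    range (fun k => level i j k q)
      = {lam | BoundaryPhase i j (mathieuAngle 1 i lam q (π / 2))} := by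
  ext lam
  simp only [mem_range, mem_ofPred_eq, boundaryPhase_iff
    (mathieuAngle_pos (i := i) one_pos lam q Real.pi_div_two_pos)]
  refine exists_congr fun k => ?_
  rw [← mathieuAngle_one_level]
  constructor
  · rintro rfl; rfl
  · exact fun h =>
      ((mathieuAngle_strictMono (i := i) one_pos q Real.pi_div_two_pos).injective h).symm

end

/-! ### From the `L²` eigenvalue problem to the classical one -/

/-- The normalised Haar measure of the circle. -/
local notation "haarT" => AddCircle.haarAddCircle (T := 2 * π)

lemma continuous_sinSq : Continuous sinSq := Real.Angle.continuous_sin.pow 2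

lemma sinSq_coe (x : ℝ) : sinSq (x : Torus) = Real.sin x ^ 2 :=
  congrArg (· ^ 2) (Real.Angle.sin_coe x)

lemma continuous_coe_torus : Continuous (fun x : ℝ => (x : Torus)) :=
  AddCircle.continuous_mk' (2 * π)

lemma coe_torus_surjective : Function.Surjective (fun x : ℝ => (x : Torus)) :=
  QuotientAddGroup.mk_surjective

/-- A continuous `2π`-periodic function descends to the circle. -/
lemma exists_continuousMap_of_periodic {u : ℝ → ℂ} (hu : Continuous u)
    (hp : Function.Periodic u (2 * π)) : ∃ F : C(Torus, ℂ), ∀ x : ℝ, F (x : Torus) = u x :=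
  ⟨⟨hp.lift, hu.quotient_liftOn' _⟩, fun _ => rfl⟩

lemma ae_coe_of_ae {p : Torus → Prop} (h : ∀ᵐ x ∂haarT, p x) :
    ∀ᵐ φ : ℝ ∂(volume.restrict (Ioc 0 (2 * π))), p (φ : Torus) := by
  have h1 : ∀ᵐ x ∂(volume : Measure Torus), p x := by
    rw [AddCircle.volume_eq_smul_haarAddCircle]
    exact Measure.ae_smul_measure h _
  have h2 := (AddCircle.measurePreserving_mk (2 * π) 0).quasiMeasurePreserving.ae h1
  simpa using h2

lemma integral_mul_congr_of_ae {f g : Torus → ℂ} (h : f =ᵐ[haarT] g) (ψ : ℝ → ℂ) :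
    ∫ φ in (0 : ℝ)..(2 * π), f (φ : Torus) * ψ φ
      = ∫ φ in (0 : ℝ)..(2 * π), g (φ : Torus) * ψ φ := by
  rw [intervalIntegral.integral_of_le Real.two_pi_pos.le,
    intervalIntegral.integral_of_le Real.two_pi_pos.le]
  refine integral_congr_ae ?_
  filter_upwards [ae_coe_of_ae h] with φ hφ
  rw [hφ]

/-- Two continuous functions that agree almost everywhere for Haar measure agree everywhere, and
reflection and translation preserve null sets. -/
lemma inClass_iff {i j : Fin 2} {f : L2} {F : C(Torus, ℂ)} (h : f =ᵐ[haarT] F) :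
    InClass i j f ↔ (∀ x : ℝ, F ((-x : ℝ) : Torus) = (-1 : ℂ) ^ (i : ℕ) * F (x : Torus)) ∧
      (∀ x : ℝ, F ((π + x : ℝ) : Torus) = (-1 : ℂ) ^ (j : ℕ) * F (x : Torus)) := by
  have hneg : (fun x => f (-x)) =ᵐ[haarT] fun x => F (-x) :=
    (Measure.measurePreserving_neg haarT).quasiMeasurePreserving.ae_eq_comp h
  have hadd : (fun x => f (((π : ℝ) : Torus) + x)) =ᵐ[haarT]
      fun x => F (((π : ℝ) : Torus) + x) :=
    (measurePreserving_add_left haarT ((π : ℝ) : Torus)).quasiMeasurePreserving.ae_eq_comp h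
  have key : ∀ {G : Torus → Torus} (_ : Continuous G) (c : ℂ)
      (_ : (fun x => f (G x)) =ᵐ[haarT] fun x => F (G x)),
      (∀ᵐ x ∂haarT, f (G x) = c * f x) ↔ ∀ x, F (G x) = c * F x := by
    intro G hG c hfG
    have h1 : (∀ᵐ x ∂haarT, f (G x) = c * f x) ↔
        (fun x => F (G x)) =ᵐ[haarT] fun x => c * F x := by
      refine eventually_congr ?_
      filter_upwards [h, hfG] with x hx hx'
      rw [← hx, ← hx']
    rw [h1, Continuous.ae_eq_iff_eq haarT (by fun_prop) (by fun_prop)]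
    exact funext_iff
  unfold InClass
  rw [key continuous_neg _ hneg, key (continuous_const_add ((π : ℝ) : Torus)) _ hadd]
  refine and_congr ?_ ?_
  · exact ⟨fun h x => h x, fun h x => by obtain ⟨y, rfl⟩ := coe_torus_surjective x; exact h y⟩
  · exact ⟨fun h x => h x, fun h x => by obtain ⟨y, rfl⟩ := coe_torus_surjective x; exact h y⟩

/-- Green's formula. -/
lemma integral_green {u u₁ u₂ w w₁ w₂ : ℝ → ℂ} (hu : ∀ x, HasDerivAt u (u₁ x) x)
    (hu₁ : ∀ x, HasDerivAt u₁ (u₂ x) x) (hw : ∀ x, HasDerivAt w (w₁ x) x)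
    (hw₁ : ∀ x, HasDerivAt w₁ (w₂ x) x) (hu₂ : Continuous u₂) (hw₂ : Continuous w₂) (a b : ℝ) :
    ∫ x in a..b, (u x * w₂ x - u₂ x * w x)
      = (u b * w₁ b - u₁ b * w b) - (u a * w₁ a - u₁ a * w a) := by
  have hcu : Continuous u := continuous_iff_continuousAt.2 fun x => (hu x).continuousAt
  have hcw : Continuous w := continuous_iff_continuousAt.2 fun x => (hw x).continuousAt
  refine intervalIntegral.integral_eq_sub_of_hasDerivAt
    (f := fun x => u x * w₁ x - u₁ x * w x) (fun x _ => ?_)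
    (((hcu.mul hw₂).sub (hu₂.mul hcw)).intervalIntegrable _ _)
  convert! ((hu x).mul (hw₁ x)).sub ((hu₁ x).mul (hw x)) using 1
  ring

lemma periodic_deriv {u u₁ : ℝ → ℂ} {c : ℝ} (hu : ∀ x, HasDerivAt u (u₁ x) x)
    (hp : Function.Periodic u c) : Function.Periodic u₁ c := by
  intro x
  have h1 : HasDerivAt (fun y => u (y + c)) (u₁ (x + c)) x := (hu (x + c)).comp_add_const x c
  have h2 : (fun y => u (y + c)) = u := funext hp
  rw [h2] at h1
  exact h1.unique (hu x)

/-- Two integrations by parts; the boundary terms at 0 and c cancel by periodicity. -/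
lemma integral_mul_iteratedDeriv_two {u u₁ u₂ ψ : ℝ → ℂ} (hu : ∀ x, HasDerivAt u (u₁ x) x)
    (hu₁ : ∀ x, HasDerivAt u₁ (u₂ x) x) (hu₂ : Continuous u₂) {c : ℝ}
    (hp : Function.Periodic u c) (hψ : ContDiff ℝ ∞ ψ) (hψp : Function.Periodic ψ c) :
    ∫ x in (0 : ℝ)..c, u x * iteratedDeriv 2 ψ x = ∫ x in (0 : ℝ)..c, u₂ x * ψ x := by
  have h2 : iteratedDeriv 2 ψ = deriv (deriv ψ) := by
    rw [iteratedDeriv_succ, iteratedDeriv_one]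
  have hd : ∀ x, HasDerivAt ψ (deriv ψ x) x := fun x =>
    (hψ.differentiable (by simp) x).hasDerivAt
  have hψ1 : ContDiff ℝ ∞ (deriv ψ) := hψ.deriv' (n := ∞)
  have hd1 : ∀ x, HasDerivAt (deriv ψ) (iteratedDeriv 2 ψ x) x := fun x => by
    rw [h2]; exact (hψ1.differentiable (by simp) x).hasDerivAt
  have hc2 : Continuous (iteratedDeriv 2 ψ) := by
    rw [h2]; exact (hψ1.deriv' (n := ∞)).continuous
  have hcu : Continuous u := continuous_iff_continuousAt.2 fun x => (hu x).continuousAt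
  have hg := integral_green hu hu₁ hd hd1 hu₂ hc2 0 c
  have e1 := hp 0
  have e2 := periodic_deriv hu hp 0
  have e3 := hψp 0
  have e4 := periodic_deriv hd hψp 0
  rw [zero_add] at e1 e2 e3 e4
  rw [e1, e2, e3, e4, sub_self] at hg
  rw [← sub_eq_zero, ← hg]
  exact (intervalIntegral.integral_sub ((hcu.mul hc2).intervalIntegrable _ _)
    ((hu₂.mul hψ.continuous).intervalIntegrable _ _)).symm

/-- A classical eigenfunction gives an eigenvalue. -/
lemma mem_eigenvalueSet_of_classical {i j : Fin 2} {q lam : ℝ} {u u₁ : ℝ → ℂ} {x₀ : ℝ}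
    (h0 : u x₀ ≠ 0) (hu : ∀ x, HasDerivAt u (u₁ x) x)
    (hu₁ : ∀ x, HasDerivAt u₁ ((q * Real.sin x ^ 2 - lam) • u x) x)
    (hi : ∀ x, u (-x) = (-1 : ℂ) ^ (i : ℕ) * u x)
    (hj : ∀ x, u (π + x) = (-1 : ℂ) ^ (j : ℕ) * u x) : lam ∈ eigenvalueSet i j q := by
  have hcu : Continuous u := continuous_iff_continuousAt.2 fun x => (hu x).continuousAt
  have hp : Function.Periodic u (2 * π) := fun x => by
    rw [show x + 2 * π = π + (π + x) by ring, hj, hj, ← mul_assoc, ← mul_pow]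
    norm_num
  obtain ⟨F, hF⟩ := exists_continuousMap_of_periodic hcu hp
  set G : C(Torus, ℂ) := ⟨fun x => ((q * sinSq x - lam : ℝ) : ℂ) * F x, by
    have := continuous_sinSq
    fun_prop⟩ with hG
  set f : L2 := ContinuousMap.toLp (E := ℂ) 2 haarT ℂ F with hf
  set g : L2 := ContinuousMap.toLp (E := ℂ) 2 haarT ℂ G with hg
  have hfF : f =ᵐ[haarT] F := ContinuousMap.coeFn_toLp haarT F
  have hgG : g =ᵐ[haarT] G := ContinuousMap.coeFn_toLp haarT G
  refine ⟨f, fun hf0 => ?_, (inClass_iff hfF).2 ⟨fun x => ?_, fun x => ?_⟩, g, ?_, ?_⟩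
  · have h1 : (F : Torus → ℂ) =ᵐ[haarT] fun _ => 0 := by
      refine hfF.symm.trans ?_
      rw [hf0]
      exact Lp.coeFn_zero _ _ _
    rw [Continuous.ae_eq_iff_eq haarT F.continuous continuous_const] at h1
    exact h0 (by rw [← hF, h1])
  · rw [hF, hF, hi]
  · rw [hF, hF, hj]
  · intro ψ hψ hψp
    rw [integral_mul_congr_of_ae hfF, integral_mul_congr_of_ae hgG]
    simp only [hF, hG, ContinuousMap.coe_mk, sinSq_coe]
    refine (integral_mul_iteratedDeriv_two hu hu₁ (by fun_prop) hp hψ hψp).trans ?_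
    simp only [Complex.real_smul]
  · filter_upwards [Lp.coeFn_smul (lam : ℂ) f, hfF, hgG] with x h1 h2 h3
    rw [h1, Pi.smul_apply, h3, h2, hG]
    simp only [ContinuousMap.coe_mk, smul_eq_mul]
    push_cast
    ring

/-! ### Regularity of weak solutions by Fourier series -/

lemma hasDerivAt_fourierTest (n : ℤ) (x : ℝ) :
    HasDerivAt (fun x : ℝ => (fourier n (x : Torus) : ℂ))
      (Complex.I * n * fourier n (x : Torus)) x := by
  convert! hasDerivAt_fourier (2 * π) n x using 1
  have : (π : ℂ) ≠ 0 := by exact_mod_cast Real.pi_ne_zero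
  push_cast
  field_simp

lemma contDiff_fourierTest (n : ℤ) :
    ContDiff ℝ ∞ (fun x : ℝ => (fourier n (x : Torus) : ℂ)) := by
  simp only [fourier_coe_apply]
  have h1 : ContDiff ℝ ∞ (fun x : ℝ => (x : ℂ)) := Complex.ofRealCLM.contDiff
  exact ((contDiff_const.mul h1).div_const _).cexp

lemma periodic_fourierTest (n : ℤ) :
    Function.Periodic (fun x : ℝ => (fourier n (x : Torus) : ℂ)) (2 * π) := fun x => by
  simp only [AddCircle.coe_add_period]

lemma iteratedDeriv_two_fourierTest (n : ℤ) :
    iteratedDeriv 2 (fun x : ℝ => (fourier n (x : Torus) : ℂ))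
      = fun x : ℝ => -(n : ℂ) ^ 2 * fourier n (x : Torus) := by
  rw [iteratedDeriv_succ, iteratedDeriv_one]
  have h1 : deriv (fun x : ℝ => (fourier n (x : Torus) : ℂ))
      = fun x : ℝ => Complex.I * n * fourier n (x : Torus) :=
    funext fun x => (hasDerivAt_fourierTest n x).deriv
  rw [h1]
  funext x
  rw [((hasDerivAt_fourierTest n x).const_mul _).deriv]
  have := Complex.I_sq
  linear_combination (n : ℂ) ^ 2 * fourier n (x : Torus) * this

lemma fourierCoeff_eq_integral_mul (f : Torus → ℂ) (n : ℤ) :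
    fourierCoeff f n = (1 / (2 * π)) •
      ∫ x in (0 : ℝ)..(2 * π), f (x : Torus) * fourier (-n) (x : Torus) := by
  rw [fourierCoeff_eq_intervalIntegral f n 0, zero_add]
  simp only [smul_eq_mul, mul_comm]

/-- Fourier coefficients of a weak second derivative. -/
lemma IsWeakSecondDeriv.fourierCoeff_eq {f g : L2} (h : IsWeakSecondDeriv f g) (n : ℤ) :
    fourierCoeff g n = -(n : ℂ) ^ 2 * fourierCoeff f n := by
  have h1 := h _ (contDiff_fourierTest (-n)) (periodic_fourierTest (-n))
  rw [iteratedDeriv_two_fourierTest] at h1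
  rw [fourierCoeff_eq_integral_mul, fourierCoeff_eq_integral_mul, ← h1, mul_smul_comm,
    ← intervalIntegral.integral_const_mul]
  congr 2
  funext x
  push_cast
  ring

/-- The n-th coefficient of g is -n² times that of f and is bounded by the L² norm of g, so the
coefficients of f are O(n⁻²). -/
lemma IsWeakSecondDeriv.summable_fourierCoeff {f g : L2} (h : IsWeakSecondDeriv f g) :
    Summable (fun n => ‖fourierCoeff f n‖) := by
  have hb : ∀ n : ℤ, ‖fourierCoeff g n‖ ≤ ‖fourierBasis.repr g‖ := fun n => by
    rw [← fourierBasis_repr]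
    exact lp.norm_apply_le_norm (by simp) _ n
  have hs : Summable (fun n : ℤ => ‖fourierBasis.repr g‖ * (1 / (n : ℝ) ^ 2)) :=
    (Real.summable_one_div_int_pow.2 one_lt_two).mul_left _
  refine Summable.of_norm_bounded_eventually hs ?_
  have h0 : ∀ᶠ n : ℤ in cofinite, n ≠ 0 := by
    rw [eventually_cofinite]
    simp
  filter_upwards [h0] with n hn
  have hn' : 0 < (n : ℝ) ^ 2 := by positivity
  rw [norm_norm, mul_one_div, le_div_iff₀ hn']
  refine le_trans (le_of_eq ?_) (hb n)
  rw [h.fourierCoeff_eq, norm_mul, norm_neg, norm_pow, mul_comm]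
  congr 1
  rw [Complex.norm_intCast, sq_abs]

lemma IsWeakSecondDeriv.exists_continuous {f g : L2} (h : IsWeakSecondDeriv f g) :
    ∃ F : C(Torus, ℂ), f =ᵐ[haarT] F := by
  have hs : Summable (fun n => fourierCoeff f n • (fourier n : C(Torus, ℂ))) := by
    refine Summable.of_norm ?_
    simp_rw [norm_smul, fourier_norm, mul_one]
    exact h.summable_fourierCoeff
  obtain ⟨F, hF⟩ := hs
  refine ⟨F, ?_⟩
  have h1 := hF.mapL (ContinuousMap.toLp (E := ℂ) 2 haarT ℂ)
  simp only [map_smul] at h1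
  rw [(hasSum_fourier_series_L2 f).unique h1]
  exact ContinuousMap.coeFn_toLp haarT F

/-- A continuous function on the circle orthogonal to all nonconstant exponentials is constant. -/
lemma eq_const_of_fourierCoeff_eq_zero {D : C(Torus, ℂ)}
    (h : ∀ n : ℤ, n ≠ 0 → fourierCoeff D n = 0) (x : Torus) : D x = fourierCoeff D 0 := by
  have hs : Summable (fourierCoeff D) :=
    summable_of_ne_finset_zero (s := {0}) fun n hn => h n (by simpa using hn)
  have h1 := has_pointwise_sum_fourier_series_of_summable hs x
  have h2 := hasSum_single (f := fun n => fourierCoeff D n • (fourier n x : ℂ)) 0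
    (fun n hn => by simp [h n hn])
  rw [h1.unique h2]
  simp

/-- A continuous weak solution of `F'' = H` with `H` continuous is a classical solution. -/
lemma exists_hasDerivAt_of_weak {F H : C(Torus, ℂ)}
    (h : ∀ ψ : ℝ → ℂ, ContDiff ℝ ∞ ψ → Function.Periodic ψ (2 * π) →
      ∫ φ in (0 : ℝ)..(2 * π), F (φ : Torus) * iteratedDeriv 2 ψ φ
        = ∫ φ in (0 : ℝ)..(2 * π), H (φ : Torus) * ψ φ) :
    ∃ u₁ : ℝ → ℂ, (∀ x : ℝ, HasDerivAt (fun x : ℝ => F (x : Torus)) (u₁ x) x) ∧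
      ∀ x : ℝ, HasDerivAt u₁ (H (x : Torus)) x := by
  have hH : Continuous (fun x : ℝ => H (x : Torus)) := H.continuous.comp continuous_coe_torus
  have hHp : Function.Periodic (fun x : ℝ => H (x : Torus)) (2 * π) := fun x => by
    simp only [AddCircle.coe_add_period]
  set v : ℝ → ℂ := fun x => ∫ t in (0 : ℝ)..x, H (t : Torus) with hv
  have hv' : ∀ x : ℝ, HasDerivAt v (H (x : Torus)) x := fun x => hH.integral_hasStrictDerivAt 0 x
    |>.hasDerivAt
  have hvc : Continuous v := continuous_iff_continuousAt.2 fun x => (hv' x).continuousAt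
  -- Subtracting the mean of v makes the second antiderivative periodic.
  set c : ℂ := (∫ t in (0 : ℝ)..(2 * π), v t) / (2 * π : ℝ) with hc
  set y : ℝ → ℂ := fun x => ∫ t in (0 : ℝ)..x, (v t - c) with hy
  have hy' : ∀ x, HasDerivAt y (v x - c) x := fun x =>
    ((hvc.sub continuous_const).integral_hasStrictDerivAt 0 x).hasDerivAt
  have hyc : Continuous y := continuous_iff_continuousAt.2 fun x => (hy' x).continuousAt
  -- The test function 1 shows that H has mean zero, which is what makes v periodic.
  have hint : ∫ t in (0 : ℝ)..(2 * π), H (t : Torus) = 0 := by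
    have := h (fun _ => 1) contDiff_const (fun _ => rfl)
    have h2 : iteratedDeriv 2 (fun _ : ℝ => (1 : ℂ)) = fun _ => 0 := by
      rw [iteratedDeriv_succ, iteratedDeriv_one]; simp
    rw [h2] at this
    simpa using this.symm
  have hvp : Function.Periodic v (2 * π) := fun x => by
    have h1 := intervalIntegral.integral_add_adjacent_intervals
      (hH.intervalIntegrable (μ := volume) 0 x) (hH.intervalIntegrable x (x + 2 * π))
    have h2 := hHp.intervalIntegral_add_eq x 0
    rw [zero_add, hint] at h2
    rw [hv]
    simp only
    rw [← h1, h2, add_zero]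
  have hint' : ∫ t in (0 : ℝ)..(2 * π), (v t - c) = 0 := by
    have h2π : ((2 * π : ℝ) : ℂ) ≠ 0 := by exact_mod_cast Real.two_pi_pos.ne'
    rw [intervalIntegral.integral_sub (hvc.intervalIntegrable _ _) (by simp),
      intervalIntegral.integral_const, sub_zero, Complex.real_smul, hc, mul_div_cancel₀ _ h2π,
      sub_self]
  have hyp : Function.Periodic y (2 * π) := fun x => by
    have hcv : Continuous (fun t => v t - c) := hvc.sub continuous_const
    have h1 := intervalIntegral.integral_add_adjacent_intervals
      (hcv.intervalIntegrable (μ := volume) 0 x) (hcv.intervalIntegrable x (x + 2 * π))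
    have hp' : Function.Periodic (fun t => v t - c) (2 * π) := fun t => by
      simp only [hvp t]
    have h2 := hp'.intervalIntegral_add_eq x 0
    rw [zero_add, hint'] at h2
    rw [hy]
    simp only
    rw [← h1, h2, add_zero]
  obtain ⟨Y, hY⟩ := exists_continuousMap_of_periodic hyc hyp
  -- F and the classical solution Y have the same weak second derivative, so they can differ only in
  -- the zeroth Fourier mode.
  have hD : ∀ n : ℤ, n ≠ 0 → fourierCoeff (F - Y : C(Torus, ℂ)) n = 0 := by
    intro n hn
    have e1 := h _ (contDiff_fourierTest (-n)) (periodic_fourierTest (-n))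
    have e2 := integral_mul_iteratedDeriv_two hy' (fun x => (hv' x).sub_const c) hH hyp
      (contDiff_fourierTest (-n)) (periodic_fourierTest (-n))
    have hF : Continuous (fun x : ℝ => F (x : Torus)) := F.continuous.comp continuous_coe_torus
    have hn2 : Continuous (fun x : ℝ => (fourier (-n) (x : Torus) : ℂ)) :=
      (contDiff_fourierTest (-n)).continuous
    rw [iteratedDeriv_two_fourierTest] at e1 e2
    have e3 : -(n : ℂ) ^ 2 * ∫ x in (0 : ℝ)..(2 * π),
        (F - Y : C(Torus, ℂ)) (x : Torus) * fourier (-n) (x : Torus) = 0 := by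
      rw [← intervalIntegral.integral_const_mul, ← sub_eq_zero.2 (e1.trans e2.symm)]
      refine Eq.trans ?_ (intervalIntegral.integral_sub
        ((hF.mul (continuous_const.mul hn2)).intervalIntegrable _ _)
        ((hyc.mul (continuous_const.mul hn2)).intervalIntegrable _ _))
      congr 1
      funext x
      simp only [ContinuousMap.sub_apply, hY]
      push_cast
      ring
    have hn' : -(n : ℂ) ^ 2 ≠ 0 := neg_ne_zero.2 (pow_ne_zero _ (by exact_mod_cast hn))
    rw [fourierCoeff_eq_integral_mul, (mul_eq_zero.1 e3).resolve_left hn', smul_zero]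
  have hFY : (fun x : ℝ => F (x : Torus))
      = fun x : ℝ => y x + fourierCoeff (F - Y : C(Torus, ℂ)) 0 := by
    funext x
    have := eq_const_of_fourierCoeff_eq_zero hD (x : Torus)
    rw [← this, ContinuousMap.sub_apply, hY]
    ring
  refine ⟨fun x => v x - c, fun x => ?_, fun x => (hv' x).sub_const c⟩
  rw [hFY]
  exact (hy' x).add_const _

/-- An eigenvalue has a classical eigenfunction. -/
lemma exists_classical_of_mem_eigenvalueSet {i j : Fin 2} {q lam : ℝ}
    (h : lam ∈ eigenvalueSet i j q) : ∃ u u₁ : ℝ → ℂ, (∃ x₀, u x₀ ≠ 0) ∧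
      (∀ x, HasDerivAt u (u₁ x) x) ∧
      (∀ x, HasDerivAt u₁ ((q * Real.sin x ^ 2 - lam) • u x) x) ∧
      (∀ x, u (-x) = (-1 : ℂ) ^ (i : ℕ) * u x) ∧
      (∀ x, u (π + x) = (-1 : ℂ) ^ (j : ℕ) * u x) := by
  obtain ⟨f, hf0, hcl, g, hfg, hg⟩ := h
  obtain ⟨F, hF⟩ := hfg.exists_continuous
  set H : C(Torus, ℂ) := ⟨fun x => ((q * sinSq x - lam : ℝ) : ℂ) * F x, by
    have := continuous_sinSq
    fun_prop⟩ with hH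
  have hgH : g =ᵐ[haarT] H := by
    filter_upwards [hg, hF, Lp.coeFn_smul (lam : ℂ) f] with x h1 h2 h3
    rw [h3, Pi.smul_apply, h2, smul_eq_mul] at h1
    rw [hH]
    simp only [ContinuousMap.coe_mk]
    push_cast
    linear_combination h1
  obtain ⟨u₁, hu, hu₁⟩ := exists_hasDerivAt_of_weak (F := F) (H := H) fun ψ hψ hψp => by
    rw [← integral_mul_congr_of_ae hF, ← integral_mul_congr_of_ae hgH]
    exact hfg ψ hψ hψp
  obtain ⟨hi, hj⟩ := (inClass_iff hF).1 hcl
  refine ⟨_, u₁, ?_, hu, fun x => ?_, hi, hj⟩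
  · by_contra! hne
    refine hf0 ((Lp.eq_zero_iff_ae_eq_zero).2 (hF.trans (Eventually.of_forall fun x => ?_)))
    obtain ⟨y, rfl⟩ := coe_torus_surjective x
    exact hne y
  · convert! hu₁ x using 1

section

/-! ### Solutions with a given Prüfer angle, and the eigenvalue enumeration -/

/-- The amplitude belonging to a Prüfer angle. -/
noncomputable def pruferAmplitude (P Q θ : ℝ → ℝ) (x : ℝ) : ℝ :=
  Real.exp (∫ t in (0 : ℝ)..x, (P t - Q t) * (Real.sin (θ t) * Real.cos (θ t)))

lemma pruferAmplitude_pos (P Q θ : ℝ → ℝ) (x : ℝ) : 0 < pruferAmplitude P Q θ x :=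
  Real.exp_pos _

section Amplitude

variable {P Q θ : ℝ → ℝ}

lemma IsPruferAngle.hasDerivAt_amplitude (h : IsPruferAngle P Q θ) (hP : Continuous P)
    (hQ : Continuous Q) (x : ℝ) :
    HasDerivAt (pruferAmplitude P Q θ)
      (pruferAmplitude P Q θ x * ((P x - Q x) * (Real.sin (θ x) * Real.cos (θ x)))) x := by
  have hc := h.continuous
  have h1 : Continuous (fun t => (P t - Q t) * (Real.sin (θ t) * Real.cos (θ t))) := by fun_prop
  exact (h1.integral_hasStrictDerivAt 0 x).hasDerivAt.exp

lemma IsPruferAngle.hasDerivAt_sin (h : IsPruferAngle P Q θ) (hP : Continuous P)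
    (hQ : Continuous Q) (x : ℝ) :
    HasDerivAt (fun x => pruferAmplitude P Q θ x * Real.sin (θ x))
      (P x * (pruferAmplitude P Q θ x * Real.cos (θ x))) x := by
  convert! (h.hasDerivAt_amplitude hP hQ x).mul (h x).sin using 1
  rw [pruferField_eq]
  have := Real.sin_sq_add_cos_sq (θ x)
  ring

lemma IsPruferAngle.hasDerivAt_cos (h : IsPruferAngle P Q θ) (hP : Continuous P)
    (hQ : Continuous Q) (x : ℝ) :
    HasDerivAt (fun x => pruferAmplitude P Q θ x * Real.cos (θ x))
      (-(Q x * (pruferAmplitude P Q θ x * Real.sin (θ x)))) x := by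
  convert! (h.hasDerivAt_amplitude hP hQ x).mul (h x).cos using 1
  rw [pruferField_eq]
  have := Real.cos_sq' (θ x)
  linear_combination (-pruferAmplitude P Q θ x * Real.sin (θ x) * (P x - Q x)) * this

end Amplitude

/-- Uniqueness for second order linear equations with bounded coefficient. -/
lemma eq_zero_of_second_order {E : Type*} [NormedAddCommGroup E] [NormedSpace ℝ E] {c : ℝ → ℝ}
    {C : ℝ} (hc : ∀ x, |c x| ≤ C) {u v : ℝ → E} (hu : ∀ x, HasDerivAt u (v x) x)
    (hv : ∀ x, HasDerivAt v (c x • u x) x) {a : ℝ} (hua : u a = 0) (hva : v a = 0) (x : ℝ) :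
    u x = 0 := by
  have hC : 0 ≤ C := (abs_nonneg _).trans (hc 0)
  have h := ODE_solution_unique_univ (E := E × E) (v := fun t p => (p.2, c t • p.1))
    (s := fun _ => univ) (K := Real.toNNReal (max 1 C)) (f := fun x => (u x, v x))
    (g := fun _ => (0, 0)) (t₀ := a)
    (fun t => LipschitzOnWith.of_dist_le_mul fun p _ r _ => ?_)
    (fun t => ⟨(hu t).prodMk (hv t), trivial⟩)
    (fun t => ⟨(hasDerivAt_const t ((0, 0) : E × E)).congr_deriv (by rw [smul_zero]; rfl), trivial⟩)
    (by simp [hua, hva])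
  · exact congrArg Prod.fst (congrFun h x)
  · rw [Real.coe_toNNReal _ (by positivity), Prod.dist_eq, Prod.dist_eq]
    refine max_le ?_ ?_
    · calc dist p.2 r.2 ≤ 1 * max (dist p.1 r.1) (dist p.2 r.2) := by
            rw [one_mul]; exact le_max_right _ _
        _ ≤ _ := mul_le_mul_of_nonneg_right (le_max_left _ _) (by positivity)
    · simp only [dist_eq_norm, ← smul_sub, norm_smul, Real.norm_eq_abs]
      exact mul_le_mul ((hc t).trans (le_max_right _ _)) (le_max_left _ _) (norm_nonneg _)
        (by positivity)

lemma abs_mathieu_le (q lam x : ℝ) : |q * Real.sin x ^ 2 - lam| ≤ |q| + |lam| := by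
  refine (abs_sub _ _).trans (add_le_add ?_ le_rfl)
  rw [abs_mul, abs_of_nonneg (sq_nonneg (Real.sin x))]
  exact mul_le_of_le_one_right (abs_nonneg _) (Real.sin_sq_le_one x)

/-- A solution which is even or odd to first order at `a` is so globally. -/
lemma reflect_of_initial {c : ℝ → ℝ} {C : ℝ} (hc : ∀ x, |c x| ≤ C) {u v : ℝ → ℝ}
    (hu : ∀ x, HasDerivAt u (v x) x) (hv : ∀ x, HasDerivAt v (c x * u x) x) {a s : ℝ}
    (hca : ∀ x, c (2 * a - x) = c x) (hs : (s = 1 ∧ v a = 0) ∨ (s = -1 ∧ u a = 0)) (x : ℝ) :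
    u (2 * a - x) = s * u x := by
  -- The difference of the reflected solution and s u solves the same equation with zero data at a.
  have h1 : ∀ x, HasDerivAt (fun x => u (2 * a - x) - s * u x) (-v (2 * a - x) - s * v x) x := by
    intro x
    exact ((hu (2 * a - x)).comp_const_sub (2 * a) x).sub ((hu x).const_mul s)
  have h2 : ∀ x, HasDerivAt (fun x => -v (2 * a - x) - s * v x)
      (c x • (u (2 * a - x) - s * u x)) x := by
    intro x
    convert! ((hv (2 * a - x)).comp_const_sub (2 * a) x).neg.sub ((hv x).const_mul s) using 1
    rw [hca, smul_eq_mul]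
    ring
  have h3 := eq_zero_of_second_order hc h1 h2 (a := a) ?_ ?_ x
  · exact sub_eq_zero.1 h3
  · rw [show 2 * a - a = a by ring]
    rcases hs with ⟨rfl, -⟩ | ⟨-, h0⟩
    · ring
    · rw [h0]; ring
  · rw [show 2 * a - a = a by ring]
    rcases hs with ⟨-, h0⟩ | ⟨rfl, -⟩
    · rw [h0]; ring
    · ring

/-- A globally even or odd function is so to first order. -/
lemma initial_of_reflect {u v : ℝ → ℂ} (hu : ∀ x, HasDerivAt u (v x) x) {a : ℝ} {s : ℂ}
    (h : ∀ x, u (2 * a - x) = s * u x) : (s = 1 → v a = 0) ∧ (s = -1 → u a = 0) := by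
  constructor
  · rintro rfl
    have h1 : HasDerivAt (fun x => u (2 * a - x)) (-v a) a := by
      have := (hu (2 * a - a)).comp_const_sub (2 * a) a
      rwa [show 2 * a - a = a by ring] at this
    have h2 : (fun x => u (2 * a - x)) = u := funext fun x => by rw [h, one_mul]
    rw [h2] at h1
    have := h1.unique (hu a)
    linear_combination (-(1 : ℂ) / 2) * this
  · rintro rfl
    have := h a
    rw [show 2 * a - a = a by ring] at this
    linear_combination (1 / 2 : ℂ) * this

lemma neg_one_pow_add_eq (i j : Fin 2) :
    (-1 : ℂ) ^ (i : ℕ) * (-1) ^ (j : ℕ) = if i = j then 1 else -1 := by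
  fin_cases i <;> fin_cases j <;> simp

variable {κ : ℝ} {i j : Fin 2} {q lam : ℝ}

/-- Parity i about 0 gives the initial phase, hence the phase on [0, π/2]. The sign under x ↦ π - x
is (-1)^(i + j), which gives u' = 0 at π/2 when i = j and u = 0 otherwise. -/
lemma boundaryPhase_of_mem_eigenvalueSet (hκ : 0 < κ) (h : lam ∈ eigenvalueSet i j q) :
    BoundaryPhase i j (mathieuAngle κ i lam q (π / 2)) := by
  obtain ⟨u, u₁, ⟨x₀, hx₀⟩, hu, hu₁, hi, hj⟩ := exists_classical_of_mem_eigenvalueSet h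
  have h0 := initial_of_reflect hu (a := 0) (s := (-1) ^ (i : ℕ)) fun x => by
    rw [← hi]; congr 1; ring
  have hh := initial_of_reflect hu (a := π / 2) (s := (-1) ^ (i : ℕ) * (-1) ^ (j : ℕ)) fun x => by
    rw [show 2 * (π / 2) - x = π + -x by ring, hj, hi]; ring
  rw [neg_one_pow_add_eq] at hh
  have hph := (isPruferAngle_mathieuAngle κ i lam q).phase_eq continuous_const
    (continuous_mathieuCoeff κ lam q) (u := u) (z := fun x => κ⁻¹ • u₁ x) (a := 0) (x := π / 2)
    (fun x => ?_) (fun x => ?_) ?_ (by positivity)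
  · have huniq := fun h1 h2 => hx₀ (eq_zero_of_second_order (abs_mathieu_le q lam) hu hu₁
      (a := π / 2) h1 h2 x₀)
    unfold BoundaryPhase
    split_ifs at hh ⊢ with hij
    · have h1 := hh.1 rfl
      rw [h1, smul_zero, smul_zero] at hph
      exact (smul_eq_zero.1 hph).resolve_right fun h2 => huniq h2 h1
    · have h1 := hh.2 rfl
      rw [h1, smul_zero, eq_comm, smul_eq_zero, smul_eq_zero] at hph
      exact hph.resolve_right fun h2 =>
        huniq h1 (h2.resolve_left (inv_ne_zero hκ.ne'))
  · rw [smul_smul, mul_inv_cancel₀ hκ.ne', one_smul]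
    exact hu x
  · convert! (hu₁ x).const_smul κ⁻¹ using 1
    rw [smul_smul, ← neg_smul]
    congr 1
    unfold mathieuCoeff
    field_simp
    ring
  · rw [mathieuAngle_zero]
    unfold startAngle
    split_ifs with hi0
    · have := h0.1 (by simp [hi0])
      simp [this]
    · have : i = 1 := by omega
      have := h0.2 (by simp [this])
      simp [this]

/-- Amplitude times the sine of the phase is a solution whose conditions at 0 and π/2 make it
symmetric or antisymmetric about each point; composing the two reflections gives the behaviour under
the shift by π. -/
lemma mem_eigenvalueSet_of_boundaryPhase (hκ : 0 < κ)
    (h : BoundaryPhase i j (mathieuAngle κ i lam q (π / 2))) : lam ∈ eigenvalueSet i j q := by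
  set θ := mathieuAngle κ i lam q with hθ
  have hp : IsPruferAngle (fun _ => κ) (mathieuCoeff κ lam q) θ :=
    isPruferAngle_mathieuAngle κ i lam q
  set r := pruferAmplitude (fun _ => κ) (mathieuCoeff κ lam q) θ with hr
  have hrpos : ∀ x, 0 < r x := pruferAmplitude_pos _ _ _
  set u : ℝ → ℝ := fun x => r x * Real.sin (θ x) with hu
  set v : ℝ → ℝ := fun x => κ * (r x * Real.cos (θ x)) with hv
  have hu' : ∀ x, HasDerivAt u (v x) x :=
    hp.hasDerivAt_sin continuous_const (continuous_mathieuCoeff κ lam q)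
  have hv' : ∀ x, HasDerivAt v ((q * Real.sin x ^ 2 - lam) * u x) x := fun x => by
    convert! (hp.hasDerivAt_cos continuous_const (continuous_mathieuCoeff κ lam q) x).const_mul κ
      using 1
    change (q * Real.sin x ^ 2 - lam) * (r x * Real.sin (θ x))
      = κ * -((lam - q * Real.sin x ^ 2) / κ * (r x * Real.sin (θ x)))
    field_simp
    ring
  have hθ0 : θ 0 = startAngle i := mathieuAngle_zero κ i lam q
  have hrefl0 := reflect_of_initial (abs_mathieu_le q lam) hu' hv' (a := 0)
    (s := (-1) ^ (i : ℕ)) (fun x => by simp) (by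
      simp only [hu, hv, hθ0, startAngle]
      fin_cases i <;> simp)
  have hreflh := reflect_of_initial (abs_mathieu_le q lam) hu' hv' (a := π / 2)
    (s := if i = j then 1 else -1) (fun x => by
      rw [show 2 * (π / 2) - x = π - x by ring, Real.sin_pi_sub]) (by
      unfold BoundaryPhase at h
      split_ifs at h ⊢
      · left; simp only [hv, h]; simp
      · right; simp only [hu, h]; simp)
  have hi : ∀ x, u (-x) = (-1) ^ (i : ℕ) * u x := fun x => by
    rw [← hrefl0]; congr 1; ring
  have hj : ∀ x, u (π + x) = (-1) ^ (j : ℕ) * u x := fun x => by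
    have h1 := hreflh (-x)
    rw [show 2 * (π / 2) - -x = π + x by ring, hi] at h1
    rw [h1, ← mul_assoc]
    congr 1
    fin_cases i <;> fin_cases j <;> simp
  have hx₀ : ∃ x₀, u x₀ ≠ 0 := by
    by_contra! hz
    have h1 : HasDerivAt u 0 0 := by
      rw [show u = fun _ => 0 from funext hz]; exact hasDerivAt_const _ _
    have h2 := (hu' 0).unique h1
    have h3 := hz 0
    simp only [hu, hv, mul_eq_zero, hκ.ne', (hrpos 0).ne', false_or] at h2 h3
    have := Real.sin_sq_add_cos_sq (θ 0)
    rw [h2, h3] at this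
    norm_num at this
  obtain ⟨x₀, hx₀⟩ := hx₀
  refine mem_eigenvalueSet_of_classical (u := fun x => (u x : ℂ)) (u₁ := fun x => (v x : ℂ))
    (x₀ := x₀) (by exact_mod_cast hx₀) (fun x => (hu' x).ofReal_comp) (fun x => ?_)
    (fun x => ?_) (fun x => ?_)
  · convert! (hv' x).ofReal_comp using 1
    rw [Complex.real_smul, ← Complex.ofReal_mul]
  · rw [hi]; push_cast; rfl
  · rw [hj]; push_cast; rfl

lemma eigenvalueSet_eq (hκ : 0 < κ) (i j : Fin 2) (q : ℝ) :
    eigenvalueSet i j q = {lam | BoundaryPhase i j (mathieuAngle κ i lam q (π / 2))} :=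
  Subset.antisymm (fun _ h => boundaryPhase_of_mem_eigenvalueSet hκ h)
    fun _ h => mem_eigenvalueSet_of_boundaryPhase hκ h

lemma range_level_eq (i j : Fin 2) (q : ℝ) :
    range (fun k => level i j k q) = eigenvalueSet i j q := by
  rw [eigenvalueSet_eq one_pos, range_level]

/-- The enumeration of the eigenvalues does not depend on the weight of the Prüfer angle. -/
lemma mathieuAngle_level (hκ : 0 < κ) (i j : Fin 2) (k : ℕ) (q : ℝ) :
    mathieuAngle κ i (level i j k q) q (π / 2) = targetAngle i j k := by
  choose ℓ hℓ using fun k => exists_mathieuAngle_eq_target hκ i j k q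
  have hmono : StrictMono ℓ := fun a b hab => by
    refine (mathieuAngle_strictMono (i := i) hκ q Real.pi_div_two_pos).lt_iff_lt.1 ?_
    simp only [hℓ]
    exact targetAngle_strictMono i j hab
  have hrange : range ℓ = eigenvalueSet i j q := by
    rw [eigenvalueSet_eq hκ]
    ext l
    rw [mem_ofPred_eq, boundaryPhase_iff (mathieuAngle_pos hκ l q Real.pi_div_two_pos)]
    refine exists_congr fun k => ?_
    rw [← hℓ]
    exact ⟨by rintro rfl; rfl, fun h =>
      ((mathieuAngle_strictMono (i := i) hκ q Real.pi_div_two_pos).injective h).symm⟩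
  -- Two strictly increasing sequences with the same range coincide.
  have heq : ℓ = fun k => level i j k q :=
    (StrictMono.range_inj hmono (level_strictMono i j q)).1 (hrange.trans (range_level_eq i j q).symm)
  rw [← hℓ k, heq]

/-- Along a strictly increasing enumeration each infimum is attained, so the default value of `sInf`
on empty or unbounded sets never enters. -/
lemma eigenvalue_eq_level (i j : Fin 2) (k : ℕ) (q : ℝ) : eigenvalue i j k q = level i j k q := by
  have hm := level_strictMono i j q
  induction k with
  | zero =>
    rw [eigenvalue, ← range_level_eq]
    refine IsLeast.csInf_eq ⟨⟨0, rfl⟩, ?_⟩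
    rintro _ ⟨k, rfl⟩
    exact hm.monotone (Nat.zero_le k)
  | succ k ih =>
    rw [eigenvalue, ← range_level_eq, ih]
    refine IsLeast.csInf_eq ⟨⟨⟨k + 1, rfl⟩, hm (Nat.lt_succ_self k)⟩, ?_⟩
    rintro _ ⟨⟨l, rfl⟩, hl⟩
    exact hm.monotone (Nat.succ_le_of_lt (hm.lt_iff_lt.1 hl))

end

section

/-! ### Differentiability of the eigenvalues -/

variable {κ : ℝ} {i j : Fin 2} {k : ℕ} {q lam : ℝ}

lemma lt_level_iff (hκ : 0 < κ) :
    lam < level i j k q ↔ mathieuAngle κ i lam q (π / 2) < targetAngle i j k := by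
  rw [← mathieuAngle_level hκ]
  exact (mathieuAngle_strictMono hκ q Real.pi_div_two_pos).lt_iff_lt.symm

lemma level_lt_iff (hκ : 0 < κ) :
    level i j k q < lam ↔ targetAngle i j k < mathieuAngle κ i lam q (π / 2) := by
  rw [← mathieuAngle_level hκ]
  exact (mathieuAngle_strictMono hκ q Real.pi_div_two_pos).lt_iff_lt.symm

/-- Being above or below a fixed a is, by monotonicity in λ, a strict inequality for the phase at λ
= a, and this is open in q. -/
lemma continuous_level (i j : Fin 2) (k : ℕ) : Continuous (level i j k) := by
  refine continuous_iff_continuousAt.2 fun q₀ => ?_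
  have hc : ∀ lam, Continuous (fun q => mathieuAngle 1 i lam q (π / 2)) := fun lam =>
    (continuous_mathieuAngle_params 1 i (by positivity : (0 : ℝ) ≤ π / 2)).comp
      (continuous_const.prodMk continuous_id)
  refine tendsto_order.2 ⟨fun a ha => ?_, fun a ha => ?_⟩
  · filter_upwards [(hc a).tendsto q₀ (Iio_mem_nhds ((lt_level_iff one_pos).1 ha))] with q hq
    exact (lt_level_iff one_pos).2 hq
  · filter_upwards [(hc a).tendsto q₀ (Ioi_mem_nhds ((level_lt_iff one_pos).1 ha))] with q hq
    exact (level_lt_iff one_pos).2 hq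

/-! ### Eigenfunctions, their dependence on the parameters, and Feynman–Hellmann -/

/-- The amplitude of the solution of parity `i` of the Mathieu equation. -/
noncomputable def mathieuAmp (i : Fin 2) (lam q : ℝ) : ℝ → ℝ :=
  pruferAmplitude (fun _ => 1) (mathieuCoeff 1 lam q) (mathieuAngle 1 i lam q)

/-- The solution of parity `i` of the Mathieu equation. -/
noncomputable def mathieuSol (i : Fin 2) (lam q x : ℝ) : ℝ :=
  mathieuAmp i lam q x * Real.sin (mathieuAngle 1 i lam q x)

/-- The derivative of the solution of parity `i` of the Mathieu equation. -/
noncomputable def mathieuSolDeriv (i : Fin 2) (lam q x : ℝ) : ℝ :=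
  mathieuAmp i lam q x * Real.cos (mathieuAngle 1 i lam q x)

lemma mathieuAmp_pos (i : Fin 2) (lam q x : ℝ) : 0 < mathieuAmp i lam q x :=
  pruferAmplitude_pos _ _ _ x

lemma hasDerivAt_mathieuSol (i : Fin 2) (lam q x : ℝ) :
    HasDerivAt (mathieuSol i lam q) (mathieuSolDeriv i lam q x) x := by
  have := (isPruferAngle_mathieuAngle 1 i lam q).hasDerivAt_sin continuous_const
    (continuous_mathieuCoeff 1 lam q) x
  rwa [one_mul] at this

lemma hasDerivAt_mathieuSolDeriv (i : Fin 2) (lam q x : ℝ) :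
    HasDerivAt (mathieuSolDeriv i lam q) ((q * Real.sin x ^ 2 - lam) * mathieuSol i lam q x) x := by
  have := (isPruferAngle_mathieuAngle 1 i lam q).hasDerivAt_cos continuous_const
    (continuous_mathieuCoeff 1 lam q) x
  convert! this using 1
  unfold mathieuSol mathieuAmp mathieuCoeff
  ring

lemma continuous_mathieuSol (i : Fin 2) (lam q : ℝ) : Continuous (mathieuSol i lam q) :=
  continuous_iff_continuousAt.2 fun x => (hasDerivAt_mathieuSol i lam q x).continuousAt

lemma continuous_mathieuSolDeriv (i : Fin 2) (lam q : ℝ) : Continuous (mathieuSolDeriv i lam q) :=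
  continuous_iff_continuousAt.2 fun x => (hasDerivAt_mathieuSolDeriv i lam q x).continuousAt

lemma exists_mathieuSol_ne_zero (i : Fin 2) (lam q : ℝ) :
    ∃ x ∈ Icc 0 (π / 2), mathieuSol i lam q x ≠ 0 := by
  by_contra! h
  have hx : π / 4 ∈ Ioo 0 (π / 2) := ⟨by positivity, by linarith [Real.pi_pos]⟩
  have h1 : HasDerivAt (mathieuSol i lam q) 0 (π / 4) := by
    refine (hasDerivAt_const _ (0 : ℝ)).congr_of_eventuallyEq ?_
    filter_upwards [Icc_mem_nhds hx.1 hx.2] with x hx using h x hx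
  have h2 := (hasDerivAt_mathieuSol i lam q (π / 4)).unique h1
  have h3 := h _ ⟨hx.1.le, hx.2.le⟩
  have hr := (mathieuAmp_pos i lam q (π / 4)).ne'
  simp only [mathieuSol, mathieuSolDeriv, mul_eq_zero, hr, false_or] at h2 h3
  have := Real.sin_sq_add_cos_sq (mathieuAngle 1 i lam q (π / 4))
  rw [h2, h3] at this
  norm_num at this

lemma integral_mathieuSol_sq_pos (i : Fin 2) (lam q : ℝ) :
    0 < ∫ x in (0 : ℝ)..(π / 2), mathieuSol i lam q x ^ 2 := by
  obtain ⟨x, hx, hne⟩ := exists_mathieuSol_ne_zero i lam q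
  exact intervalIntegral.integral_pos Real.pi_div_two_pos
    ((continuous_mathieuSol i lam q).pow 2).continuousOn (fun _ _ => sq_nonneg _)
    ⟨x, hx, by positivity⟩

lemma abs_amplitude_exponent_le (lam q v x : ℝ) :
    |(1 - mathieuCoeff 1 lam q x) * (Real.sin v * Real.cos v)| ≤ 1 + |lam| + |q| := by
  have h1 : |Real.sin v * Real.cos v| ≤ 1 := by
    rw [abs_mul]
    exact mul_le_one₀ (Real.abs_sin_le_one _) (abs_nonneg _) (Real.abs_cos_le_one _)
  rw [abs_mul]
  refine (mul_le_of_le_one_right (abs_nonneg _) h1).trans ?_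
  unfold mathieuCoeff
  rw [div_one, show 1 - (lam - q * Real.sin x ^ 2) = 1 + (q * Real.sin x ^ 2 - lam) by ring]
  have := abs_add_le 1 (q * Real.sin x ^ 2 - lam)
  have h2 := abs_mathieu_le q lam x
  rw [abs_one] at this
  linarith

lemma eventually_params_le (p : ℝ × ℝ) :
    ∀ᶠ r : ℝ × ℝ in 𝓝 p, 1 + |r.1| + |r.2| ≤ 2 + |p.1| + |p.2| := by
  have hc : Continuous (fun r : ℝ × ℝ => 1 + |r.1| + |r.2|) := by fun_prop
  filter_upwards [hc.tendsto p (Iio_mem_nhds (show _ < 2 + |p.1| + |p.2| by linarith))] with r hr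
  exact hr.le

lemma mathieuAmp_le {C : ℝ} (hC : 1 + |lam| + |q| ≤ C) {x : ℝ} (hx : x ∈ Icc 0 (π / 2)) :
    mathieuAmp i lam q x ≤ Real.exp (C * (π / 2)) := by
  unfold mathieuAmp pruferAmplitude
  rw [Real.exp_le_exp]
  have hC0 : 0 ≤ C := le_trans (by positivity) hC
  have h1 := intervalIntegral.norm_integral_le_of_norm_le_const (a := 0) (b := x) (C := C)
    (f := fun t => (1 - mathieuCoeff 1 lam q t) *
      (Real.sin (mathieuAngle 1 i lam q t) * Real.cos (mathieuAngle 1 i lam q t)))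
    fun t _ => (abs_amplitude_exponent_le lam q _ t).trans hC
  refine (le_abs_self _).trans (h1.trans ?_)
  rw [sub_zero, abs_of_nonneg hx.1]
  exact mul_le_mul_of_nonneg_left hx.2 hC0

lemma continuous_mathieuAmp_params (i : Fin 2) {x : ℝ} (hx : 0 ≤ x) :
    Continuous (fun p : ℝ × ℝ => mathieuAmp i p.1 p.2 x) := by
  unfold mathieuAmp pruferAmplitude
  refine Real.continuous_exp.comp (continuous_iff_continuousAt.2 fun p => ?_)
  refine intervalIntegral.continuousAt_of_dominated_interval
    (bound := fun _ => 2 + |p.1| + |p.2|) (Eventually.of_forall fun r => ?_) ?_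
    (by simp) (Eventually.of_forall fun t ht => ?_)
  · have h1 := (isPruferAngle_mathieuAngle 1 i r.1 r.2).continuous
    have h2 := continuous_mathieuCoeff 1 r.1 r.2
    exact Continuous.aestronglyMeasurable (by fun_prop)
  · filter_upwards [eventually_params_le p] with r hr
    exact Eventually.of_forall fun t _ => (abs_amplitude_exponent_le _ _ _ t).trans hr
  · rw [uIoc_of_le hx] at ht
    have h1 := continuous_mathieuAngle_params 1 i ht.1.le
    have h2 : Continuous (fun r : ℝ × ℝ => mathieuCoeff 1 r.1 r.2 t) := by
      unfold mathieuCoeff; fun_prop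
    exact Continuous.continuousAt (by fun_prop)

lemma continuous_mathieuSol_params (i : Fin 2) {x : ℝ} (hx : 0 ≤ x) :
    Continuous (fun p : ℝ × ℝ => mathieuSol i p.1 p.2 x) :=
  (continuous_mathieuAmp_params i hx).mul
    (Real.continuous_sin.comp (continuous_mathieuAngle_params 1 i hx))

lemma continuous_integral_mul_mathieuSol (i : Fin 2) {w : ℝ → ℝ} (hw : Continuous w) :
    Continuous (fun p : ℝ × ℝ => ∫ x in (0 : ℝ)..(π / 2), w x * mathieuSol i p.1 p.2 x) := by
  refine continuous_iff_continuousAt.2 fun p => ?_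
  refine intervalIntegral.continuousAt_of_dominated_interval
    (bound := fun x => |w x| * Real.exp ((2 + |p.1| + |p.2|) * (π / 2)))
    (Eventually.of_forall fun r => ?_) ?_
    ((hw.abs.mul continuous_const).intervalIntegrable _ _)
    (Eventually.of_forall fun t ht => ?_)
  · exact (hw.mul (continuous_mathieuSol i r.1 r.2)).aestronglyMeasurable
  · filter_upwards [eventually_params_le p] with r hr
    refine Eventually.of_forall fun t ht => ?_
    rw [uIoc_of_le (by positivity)] at ht
    rw [Real.norm_eq_abs, abs_mul]
    refine mul_le_mul_of_nonneg_left ?_ (abs_nonneg _)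
    unfold mathieuSol
    rw [abs_mul, abs_of_pos (mathieuAmp_pos i _ _ t)]
    exact (mul_le_of_le_one_right (mathieuAmp_pos i _ _ t).le (Real.abs_sin_le_one _)).trans
      (mathieuAmp_le hr ⟨ht.1.le, ht.2⟩)
  · rw [uIoc_of_le (by positivity)] at ht
    exact (continuous_const.mul (continuous_mathieuSol_params i ht.1.le)).continuousAt

lemma continuous_integral_mul_level_sol (i j : Fin 2) (k : ℕ) {w : ℝ → ℝ} (hw : Continuous w) :
    Continuous (fun q => ∫ x in (0 : ℝ)..(π / 2), w x * mathieuSol i (level i j k q) q x) := by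
  have h1 : Continuous (fun q => (level i j k q, q)) :=
    (continuous_level i j k).prodMk continuous_id
  have h2 := (continuous_integral_mul_mathieuSol i hw).comp h1
  simpa only [Function.comp_def] using h2

/-- Lagrange's identity for two eigenfunctions with the same index. -/
lemma level_sub_mul_integral (i j : Fin 2) (k : ℕ) (q₀ q : ℝ) :
    (level i j k q - level i j k q₀) * ∫ x in (0 : ℝ)..(π / 2),
        mathieuSol i (level i j k q₀) q₀ x * mathieuSol i (level i j k q) q x
      = (q - q₀) * ∫ x in (0 : ℝ)..(π / 2),
        Real.sin x ^ 2 * mathieuSol i (level i j k q₀) q₀ x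
          * mathieuSol i (level i j k q) q x := by
  set l := level i j k q with hl
  set l₀ := level i j k q₀ with hl₀
  have c1 := continuous_mathieuSol i l q
  have c2 := continuous_mathieuSol i l₀ q₀
  have h := intervalIntegral.integral_eq_sub_of_hasDerivAt (a := 0) (b := π / 2)
    (f := fun x => mathieuSol i l₀ q₀ x * mathieuSolDeriv i l q x
      - mathieuSolDeriv i l₀ q₀ x * mathieuSol i l q x)
    (f' := fun x => (q - q₀) * (Real.sin x ^ 2 * mathieuSol i l₀ q₀ x * mathieuSol i l q x)
      - (l - l₀) * (mathieuSol i l₀ q₀ x * mathieuSol i l q x))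
    (fun x _ => by
      convert! ((hasDerivAt_mathieuSol i l₀ q₀ x).mul (hasDerivAt_mathieuSolDeriv i l q x)).sub
        ((hasDerivAt_mathieuSolDeriv i l₀ q₀ x).mul (hasDerivAt_mathieuSol i l q x)) using 1
      ring)
    (Continuous.intervalIntegrable (by fun_prop) _ _)
  -- The Wronskian is the product of the amplitudes times the sine of the phase difference. The
  -- phases coincide at 0 by definition and at π/2 because the index k is the same.
  have hz : ∀ x, mathieuAngle 1 i l₀ q₀ x = mathieuAngle 1 i l q x →
      mathieuSol i l₀ q₀ x * mathieuSolDeriv i l q x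
        - mathieuSolDeriv i l₀ q₀ x * mathieuSol i l q x = 0 := by
    intro x hx
    unfold mathieuSol mathieuSolDeriv
    rw [hx]
    ring
  rw [hz 0 (by simp), hz (π / 2) (by rw [hl, hl₀, mathieuAngle_level one_pos,
    mathieuAngle_level one_pos]), intervalIntegral.integral_sub
    (Continuous.intervalIntegrable (by fun_prop) _ _)
    (Continuous.intervalIntegrable (by fun_prop) _ _), intervalIntegral.integral_const_mul,
    intervalIntegral.integral_const_mul] at h
  linarith

/-- Feynman–Hellmann: the `q`-derivative of an eigenvalue is the mean of `sin²`. -/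
theorem hasDerivAt_level (i j : Fin 2) (k : ℕ) (q₀ : ℝ) :
    HasDerivAt (level i j k)
      ((∫ x in (0 : ℝ)..(π / 2), Real.sin x ^ 2 * mathieuSol i (level i j k q₀) q₀ x ^ 2) /
        ∫ x in (0 : ℝ)..(π / 2), mathieuSol i (level i j k q₀) q₀ x ^ 2) q₀ := by
  set y := mathieuSol i (level i j k q₀) q₀ with hy
  have hyc : Continuous y := continuous_mathieuSol _ _ _
  have hN : Continuous (fun q => ∫ x in (0 : ℝ)..(π / 2),
      y x * mathieuSol i (level i j k q) q x) :=
    continuous_integral_mul_level_sol i j k hyc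
  have hA : Continuous (fun q => ∫ x in (0 : ℝ)..(π / 2),
      Real.sin x ^ 2 * y x * mathieuSol i (level i j k q) q x) :=
    continuous_integral_mul_level_sol i j k (by fun_prop)
  have hN0 : 0 < ∫ x in (0 : ℝ)..(π / 2), y x * mathieuSol i (level i j k q₀) q₀ x := by
    have := integral_mathieuSol_sq_pos i (level i j k q₀) q₀
    simpa only [sq, hy] using this
  have hlim := (hA.tendsto q₀).div (hN.tendsto q₀) hN0.ne'
  have e1 : ∀ x, Real.sin x ^ 2 * y x ^ 2
      = Real.sin x ^ 2 * y x * mathieuSol i (level i j k q₀) q₀ x := fun x => by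
    rw [← hy]; ring
  have e2 : ∀ x, y x ^ 2 = y x * mathieuSol i (level i j k q₀) q₀ x := fun x => by
    rw [← hy]; ring
  simp_rw [e1, e2]
  rw [hasDerivAt_iff_tendsto_slope]
  refine (hlim.mono_left nhdsWithin_le_nhds).congr' ?_
  filter_upwards [nhdsWithin_le_nhds (hN.tendsto q₀ (Ioi_mem_nhds hN0)), self_mem_nhdsWithin]
    with q hq hne
  have hq' : 0 < ∫ x in (0 : ℝ)..(π / 2), y x * mathieuSol i (level i j k q) q x := hq
  rw [slope_def_field, Pi.div_apply, div_eq_div_iff hq'.ne' (sub_ne_zero.2 hne)]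
  have := level_sub_mul_integral i j k q₀ q
  rw [← hy] at this
  linarith

end

section

/-! ### The virial identity -/

variable {i j : Fin 2} {k : ℕ} {q : ℝ}

/-- The mean over an eigenfunction of a weight. -/
noncomputable def eigenMean (i j : Fin 2) (k : ℕ) (q : ℝ) (w : ℝ → ℝ) : ℝ :=
  (∫ x in (0 : ℝ)..(π / 2), w x * mathieuSol i (level i j k q) q x ^ 2) /
    ∫ x in (0 : ℝ)..(π / 2), mathieuSol i (level i j k q) q x ^ 2

lemma deriv_level (i j : Fin 2) (k : ℕ) (q : ℝ) :
    deriv (level i j k) q = eigenMean i j k q (fun x => Real.sin x ^ 2) :=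
  (hasDerivAt_level i j k q).deriv

lemma eigenMean_nonneg {w : ℝ → ℝ} (hw : ∀ x, 0 ≤ w x) : 0 ≤ eigenMean i j k q w :=
  div_nonneg (intervalIntegral.integral_nonneg (by positivity)
    fun x _ => mul_nonneg (hw x) (sq_nonneg _)) (integral_mathieuSol_sq_pos i _ q).le

lemma eigenMean_le_one {w : ℝ → ℝ} (hwc : Continuous w) (hw : ∀ x, w x ≤ 1) :
    eigenMean i j k q w ≤ 1 := by
  unfold eigenMean
  rw [div_le_one (integral_mathieuSol_sq_pos i _ q)]
  have hy := continuous_mathieuSol i (level i j k q) q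
  exact intervalIntegral.integral_mono_on (by positivity)
    (Continuous.intervalIntegrable (by fun_prop) _ _)
    (Continuous.intervalIntegrable (by fun_prop) _ _)
    fun x _ => mul_le_of_le_one_left (sq_nonneg _) (hw x)

lemma eigenMean_quartic (a b c : ℝ) :
    eigenMean i j k q (fun x => a + b * Real.sin x ^ 2 + c * Real.sin x ^ 4)
      = a + b * eigenMean i j k q (fun x => Real.sin x ^ 2)
        + c * eigenMean i j k q (fun x => Real.sin x ^ 4) := by
  unfold eigenMean
  have hN := (integral_mathieuSol_sq_pos i (level i j k q) q).ne'
  have hy := continuous_mathieuSol i (level i j k q) q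
  set y := mathieuSol i (level i j k q) q
  have h1 : ∀ x, (a + b * Real.sin x ^ 2 + c * Real.sin x ^ 4) * y x ^ 2
      = a * y x ^ 2 + b * (Real.sin x ^ 2 * y x ^ 2) + c * (Real.sin x ^ 4 * y x ^ 2) :=
    fun x => by ring
  simp_rw [h1]
  rw [intervalIntegral.integral_add (Continuous.intervalIntegrable (by fun_prop) _ _)
      (Continuous.intervalIntegrable (by fun_prop) _ _),
    intervalIntegral.integral_add (Continuous.intervalIntegrable (by fun_prop) _ _)
      (Continuous.intervalIntegrable (by fun_prop) _ _),
    intervalIntegral.integral_const_mul, intervalIntegral.integral_const_mul,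
    intervalIntegral.integral_const_mul]
  field_simp

lemma mathieuSol_mul_deriv_zero (i : Fin 2) (lam q : ℝ) :
    mathieuSol i lam q 0 * mathieuSolDeriv i lam q 0 = 0 := by
  unfold mathieuSol mathieuSolDeriv
  rw [mathieuAngle_zero]
  fin_cases i <;> simp [startAngle]

lemma mathieuSol_mul_deriv_pi_div_two (i j : Fin 2) (k : ℕ) (q : ℝ) :
    mathieuSol i (level i j k q) q (π / 2) * mathieuSolDeriv i (level i j k q) q (π / 2) = 0 := by
  unfold mathieuSol mathieuSolDeriv
  have hpos := mathieuAngle_pos (i := i) one_pos (level i j k q) q Real.pi_div_two_pos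
  have h := (boundaryPhase_iff (i := i) (j := j) hpos).2 ⟨k, mathieuAngle_level one_pos i j k q⟩
  unfold BoundaryPhase at h
  split_ifs at h <;> rw [h] <;> ring

/-- An exact derivative integrates to zero against an eigenfunction; a nonnegative multiple of
`(y')²` may be dropped. -/
lemma eigenMean_nonneg_of_hasDerivAt {G p w : ℝ → ℝ} (hp : Continuous p) (hw : Continuous w)
    (hp0 : ∀ x, 0 ≤ p x)
    (hG : ∀ x, HasDerivAt G (p x * mathieuSolDeriv i (level i j k q) q x ^ 2
      - w x * mathieuSol i (level i j k q) q x ^ 2) x) (h : G (π / 2) = G 0) :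
    0 ≤ eigenMean i j k q w := by
  have hy := continuous_mathieuSol i (level i j k q) q
  have hv := continuous_mathieuSolDeriv i (level i j k q) q
  have h1 := intervalIntegral.integral_eq_sub_of_hasDerivAt (a := 0) (b := π / 2)
    (fun x _ => hG x) (Continuous.intervalIntegrable (by fun_prop) _ _)
  rw [h, sub_self, intervalIntegral.integral_sub
    (Continuous.intervalIntegrable (by fun_prop) _ _)
    (Continuous.intervalIntegrable (by fun_prop) _ _)] at h1
  refine div_nonneg ?_ (integral_mathieuSol_sq_pos i _ q).le
  rw [← sub_eq_zero.1 h1]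
  exact intervalIntegral.integral_nonneg (by positivity)
    fun x _ => mul_nonneg (hp0 x) (sq_nonneg _)

/-- Integrating (y y')' over [0, π/2] gives λ - q⟨sin²⟩ as the normalised integral of y'². -/
lemma mul_eigenMean_sin_sq_le (i j : Fin 2) (k : ℕ) (q : ℝ) :
    q * eigenMean i j k q (fun x => Real.sin x ^ 2) ≤ level i j k q := by
  set l := level i j k q with hl
  have h := eigenMean_nonneg_of_hasDerivAt (i := i) (j := j) (k := k) (q := q)
    (G := fun x => mathieuSol i l q x * mathieuSolDeriv i l q x) (p := fun _ => 1)
    (w := fun x => l + (-q) * Real.sin x ^ 2 + 0 * Real.sin x ^ 4) (by fun_prop) (by fun_prop)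
    (fun _ => zero_le_one)
    (fun x => by
      convert! (hasDerivAt_mathieuSol i l q x).mul (hasDerivAt_mathieuSolDeriv i l q x) using 1
      rw [← hl]
      ring)
    (by rw [mathieuSol_mul_deriv_zero, hl, mathieuSol_mul_deriv_pi_div_two])
  rw [eigenMean_quartic] at h
  linarith

/-- The same with weight sin²; subtracting sin x cos x y² removes the cross term y y' produced by
differentiating the weight. -/
lemma mul_eigenMean_sin_fourth_le (i j : Fin 2) (k : ℕ) (q : ℝ) :
    q * eigenMean i j k q (fun x => Real.sin x ^ 4)
      ≤ 1 + (level i j k q - 2) * eigenMean i j k q (fun x => Real.sin x ^ 2) := by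
  set l := level i j k q with hl
  have h := eigenMean_nonneg_of_hasDerivAt (i := i) (j := j) (k := k) (q := q)
    (G := fun x => Real.sin x ^ 2 * (mathieuSol i l q x * mathieuSolDeriv i l q x)
      - Real.sin x * Real.cos x * mathieuSol i l q x ^ 2) (p := fun x => Real.sin x ^ 2)
    (w := fun x => 1 + (l - 2) * Real.sin x ^ 2 + (-q) * Real.sin x ^ 4)
    (by fun_prop) (by fun_prop) (fun _ => sq_nonneg _)
    (fun x => by
      have h1 := hasDerivAt_mathieuSol i l q x
      have h2 := hasDerivAt_mathieuSolDeriv i l q x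
      have hs := Real.hasDerivAt_sin x
      have hc := Real.hasDerivAt_cos x
      convert! ((hs.pow 2).mul (h1.mul h2)).sub ((hs.mul hc).mul (h1.pow 2)) using 1
      simp only [Pi.mul_apply, Pi.pow_apply]
      have := Real.cos_sq' x
      rw [← hl]
      push_cast
      linear_combination mathieuSol i l q x ^ 2 * this)
    (by simp only [mathieuSol_mul_deriv_zero, hl, mathieuSol_mul_deriv_pi_div_two]
        simp)
  rw [eigenMean_quartic] at h
  linarith

/-- The virial identity. -/
lemma virial_identity (i j : Fin 2) (k : ℕ) (q : ℝ) :
    2 * level i j k q - 2 + (4 - 4 * q - 4 * level i j k q)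
        * eigenMean i j k q (fun x => Real.sin x ^ 2)
      + 6 * q * eigenMean i j k q (fun x => Real.sin x ^ 4) = 0 := by
  set l := level i j k q with hl
  -- With f = sin x cos x this is f (y'² + (λ - q sin²) y²) - f' y y' + f'' y² / 2, in whose
  -- derivative all terms in y' cancel. The multiplier f acts like a dilation near 0 and vanishes at
  -- both ends.
  have hG : ∀ x, HasDerivAt (fun x => Real.sin x * Real.cos x * mathieuSolDeriv i l q x ^ 2
      + Real.sin x * Real.cos x * (l - q * Real.sin x ^ 2) * mathieuSol i l q x ^ 2
      + (2 * Real.sin x ^ 2 - 1) * (mathieuSol i l q x * mathieuSolDeriv i l q x)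
      - 2 * (Real.sin x * Real.cos x) * mathieuSol i l q x ^ 2)
      ((2 * l - 2 + (4 - 4 * q - 4 * l) * Real.sin x ^ 2 + 6 * q * Real.sin x ^ 4)
        * mathieuSol i l q x ^ 2) x := by
    intro x
    have h1 := hasDerivAt_mathieuSol i l q x
    have h2 := hasDerivAt_mathieuSolDeriv i l q x
    have hs := Real.hasDerivAt_sin x
    have hc := Real.hasDerivAt_cos x
    have hsc := hs.mul hc
    convert! (((hsc.mul (h2.pow 2)).add
      ((hsc.mul (((hs.pow 2).const_mul q).const_sub l)).mul (h1.pow 2))).add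
      ((((hs.pow 2).const_mul 2).sub_const 1).mul (h1.mul h2))).sub
      ((hsc.const_mul 2).mul (h1.pow 2)) using 1
    simp only [Pi.mul_apply, Pi.pow_apply]
    have := Real.cos_sq' x
    push_cast
    linear_combination (-(mathieuSolDeriv i l q x ^ 2 + (l - 3 * q * Real.sin x ^ 2 - 2)
      * mathieuSol i l q x ^ 2)) * this
  have hy := continuous_mathieuSol i l q
  have h1 := intervalIntegral.integral_eq_sub_of_hasDerivAt (a := 0) (b := π / 2)
    (fun x _ => hG x) (Continuous.intervalIntegrable (by fun_prop) _ _)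
  simp only [mathieuSol_mul_deriv_zero, hl, mathieuSol_mul_deriv_pi_div_two, Real.sin_zero,
    Real.cos_pi_div_two, zero_mul, mul_zero, add_zero, sub_zero] at h1
  rw [← hl] at h1
  rw [← eigenMean_quartic, eigenMean, ← hl, h1, zero_div]

/-- The second limit follows from the growth rate of the eigenvalue. -/
theorem tendsto_mul_deriv_level_div {c : ℝ} (hc : 0 < c)
    (h : Tendsto (fun q => level i j k q / q ^ (1 / 2 : ℝ)) atTop (𝓝 c)) :
    Tendsto (fun q => q * deriv (level i j k) q / level i j k q) atTop (𝓝 (1 / 2)) := by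
  have hsqrt : Tendsto (fun q : ℝ => q ^ (1 / 2 : ℝ)) atTop atTop :=
    tendsto_rpow_atTop (by norm_num)
  have hl : Tendsto (fun q => level i j k q) atTop atTop := by
    refine (h.pos_mul_atTop hc hsqrt).congr' ?_
    filter_upwards [eventually_gt_atTop 0] with q hq
    exact div_mul_cancel₀ _ (Real.rpow_pos_of_pos hq _).ne'
  have hlq : Tendsto (fun q => level i j k q / q) atTop (𝓝 0) := by
    have := h.mul hsqrt.inv_tendsto_atTop
    rw [mul_zero] at this
    refine this.congr' ?_
    filter_upwards [eventually_gt_atTop 0] with q hq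
    rw [Pi.inv_apply, ← div_eq_mul_inv, div_div, ← Real.rpow_add hq]
    norm_num
  have hbound : Tendsto (fun q => 5 / 2 * (level i j k q / q) + 3 * (level i j k q)⁻¹) atTop
      (𝓝 0) := by
    have := (hlq.const_mul (5 / 2)).add (hl.inv_tendsto_atTop.const_mul 3)
    simpa using this
  refine tendsto_iff_dist_tendsto_zero.2 (squeeze_zero' (Eventually.of_forall fun _ => dist_nonneg)
    ?_ hbound)
  filter_upwards [eventually_gt_atTop 0, hl.eventually_gt_atTop 0] with q hq hlpos
  rw [deriv_level, Real.dist_eq]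
  have e1 := mul_eigenMean_sin_sq_le i j k q
  have e2 := mul_eigenMean_sin_fourth_le i j k q
  have e3 := virial_identity i j k q
  have e4 : 0 ≤ eigenMean i j k q (fun x => Real.sin x ^ 2) :=
    eigenMean_nonneg fun _ => sq_nonneg _
  have e5 : 0 ≤ eigenMean i j k q (fun x => Real.sin x ^ 4) :=
    eigenMean_nonneg fun _ => by positivity
  have e6 : eigenMean i j k q (fun x => Real.sin x ^ 2) ≤ 1 :=
    eigenMean_le_one (by fun_prop) fun x => Real.sin_sq_le_one x
  set a := eigenMean i j k q (fun x => Real.sin x ^ 2)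
  set b := eigenMean i j k q (fun x => Real.sin x ^ 4)
  set l := level i j k q
  have e7 : a ≤ l / q := by rw [le_div_iff₀ hq]; linarith
  -- The virial identity solved for q a. As a ≤ λ/q and q b ≤ 1 + (λ - 2) a, the numerator is
  -- bounded by a multiple of λ²/q plus a constant.
  have e8 : q * a / l - 1 / 2 = (-(4 * l * a) - 2 + 4 * a + 6 * (q * b)) / (4 * l) := by
    field_simp
    linarith
  have e9 : 0 ≤ q * b := by positivity
  have e10 : 0 ≤ l * a := by positivity
  rw [e8, abs_div, abs_of_pos (show 0 < 4 * l by positivity), div_le_iff₀ (by positivity)]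
  have e11 : (5 / 2 * (l / q) + 3 * l⁻¹) * (4 * l) = 10 * (l * (l / q)) + 12 := by
    field_simp
    ring
  have e12 : l * a ≤ l * (l / q) := mul_le_mul_of_nonneg_left e7 hlpos.le
  rw [e11, abs_le]
  constructor <;> nlinarith

end

section

/-! ### Hermite functions -/

/-- The probabilists' Hermite polynomial with real coefficients. -/
noncomputable def hermiteR (n : ℕ) : Polynomial ℝ :=
  (Polynomial.hermite n).map (Int.castRingHom ℝ)

open Polynomial in
lemma derivative_hermite_succ (n : ℕ) :
    derivative (hermite (n + 1)) = ((n + 1 : ℕ) : ℤ[X]) * hermite n := by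
  induction n with
  | zero => simp
  | succ n ih =>
    have h : X * derivative (hermite (n + 1)) - derivative (derivative (hermite (n + 1)))
        = ((n + 1 : ℕ) : ℤ[X]) * hermite (n + 1) := by
      rw [ih, derivative_mul, derivative_natCast, hermite_succ n]
      ring
    rw [hermite_succ (n + 1), derivative_sub, derivative_mul, derivative_X]
    push_cast at h ⊢
    linear_combination h

open Polynomial in
lemma derivative_hermiteR_succ (n : ℕ) :
    derivative (hermiteR (n + 1)) = ((n + 1 : ℕ) : ℝ[X]) * hermiteR n := by
  unfold hermiteR
  rw [derivative_map, derivative_hermite_succ, Polynomial.map_mul, Polynomial.map_natCast]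

open Polynomial in
lemma hermiteR_succ (n : ℕ) : hermiteR (n + 1) = X * hermiteR n - derivative (hermiteR n) := by
  unfold hermiteR
  rw [hermite_succ, Polynomial.map_sub, Polynomial.map_mul, map_X, derivative_map]

open Polynomial in
lemma derivative_derivative_hermiteR (n : ℕ) :
    derivative (derivative (hermiteR n))
      = X * derivative (hermiteR n) - (n : ℝ[X]) * hermiteR n := by
  have h := congrArg derivative (hermiteR_succ n)
  rw [derivative_hermiteR_succ, derivative_sub, derivative_mul, derivative_X] at h
  push_cast at h
  linear_combination h

lemma hermiteR_monic (n : ℕ) : (hermiteR n).Monic := (Polynomial.hermite_monic n).map _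

lemma natDegree_hermiteR (n : ℕ) : (hermiteR n).natDegree = n := by
  unfold hermiteR
  rw [(Polynomial.hermite_monic n).natDegree_map, Polynomial.natDegree_hermite]

lemma hermiteR_eval_add_two (n : ℕ) (x : ℝ) :
    (hermiteR (n + 2)).eval x = x * (hermiteR (n + 1)).eval x - (n + 1) * (hermiteR n).eval x := by
  rw [hermiteR_succ (n + 1), derivative_hermiteR_succ]
  simp

lemma hermiteR_eval_neg (n : ℕ) (x : ℝ) :
    (hermiteR n).eval (-x) = (-1) ^ n * (hermiteR n).eval x := by
  induction n using Nat.strong_induction_on with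
  | _ n ih =>
    match n with
    | 0 => simp [hermiteR]
    | 1 => simp [hermiteR]
    | n + 2 =>
      rw [hermiteR_eval_add_two, hermiteR_eval_add_two, ih (n + 1) (by omega), ih n (by omega)]
      ring

lemma eventually_hermiteR_pos (n : ℕ) : ∀ᶠ s : ℝ in atTop, 0 < (hermiteR n).eval s := by
  rcases Nat.eq_zero_or_pos n with rfl | hn
  · exact Eventually.of_forall fun s => by simp [hermiteR]
  · refine (Polynomial.tendsto_atTop_of_leadingCoeff_nonneg _ ?_ ?_).eventually_gt_atTop 0
    · exact Polynomial.natDegree_pos_iff_degree_pos.1 (by rwa [natDegree_hermiteR])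
    · rw [(hermiteR_monic n).leadingCoeff]; exact zero_le_one

lemma eventually_derivative_hermiteR_nonneg (n : ℕ) :
    ∀ᶠ s : ℝ in atTop, 0 ≤ (Polynomial.derivative (hermiteR n)).eval s := by
  cases n with
  | zero => exact Eventually.of_forall fun s => by simp [hermiteR]
  | succ n =>
    filter_upwards [eventually_hermiteR_pos n] with s hs
    rw [derivative_hermiteR_succ, Polynomial.eval_mul, Polynomial.eval_natCast]
    positivity

lemma eventually_derivative_hermiteR_le (n : ℕ) :
    ∀ᶠ s : ℝ in atTop, (Polynomial.derivative (hermiteR n)).eval s ≤ (hermiteR n).eval s := by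
  have h := Polynomial.div_tendsto_atTop_zero_of_degree_lt (Polynomial.derivative (hermiteR n))
    (hermiteR n) (Polynomial.degree_derivative_lt (hermiteR_monic n).ne_zero)
  filter_upwards [h (Iio_mem_nhds one_pos), eventually_hermiteR_pos n] with s h1 h2
  exact ((div_lt_one h2).1 h1).le

/-- The rescaled Hermite function. -/
noncomputable def hermiteFun (σ : ℝ) (n : ℕ) (t : ℝ) : ℝ :=
  (hermiteR n).eval (σ * t) * Real.exp (-(σ ^ 2 * t ^ 2 / 4))

/-- The derivative of the rescaled Hermite function. -/
noncomputable def hermiteFunDeriv (σ : ℝ) (n : ℕ) (t : ℝ) : ℝ :=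
  (σ * (Polynomial.derivative (hermiteR n)).eval (σ * t)
    - σ ^ 2 * t / 2 * (hermiteR n).eval (σ * t)) * Real.exp (-(σ ^ 2 * t ^ 2 / 4))

/-- The coefficient `μ - b² t²` of the harmonic oscillator equation. -/
def oscCoeff (b μ t : ℝ) : ℝ := μ - b ^ 2 * t ^ 2

lemma continuous_oscCoeff (b μ : ℝ) : Continuous (oscCoeff b μ) := by
  unfold oscCoeff
  fun_prop

lemma hasDerivAt_eval_mul (p : Polynomial ℝ) (σ t : ℝ) :
    HasDerivAt (fun t => p.eval (σ * t)) (σ * (Polynomial.derivative p).eval (σ * t)) t := by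
  have h1 : HasDerivAt (fun t : ℝ => σ * t) σ t := by
    simpa using (hasDerivAt_id t).const_mul σ
  have := (p.hasDerivAt (σ * t)).comp t h1
  rwa [mul_comm] at this

lemma hasDerivAt_gauss (σ t : ℝ) :
    HasDerivAt (fun t : ℝ => Real.exp (-(σ ^ 2 * t ^ 2 / 4)))
      (-(σ ^ 2 * t / 2) * Real.exp (-(σ ^ 2 * t ^ 2 / 4))) t := by
  have h1 : HasDerivAt (fun t : ℝ => -(σ ^ 2 * t ^ 2 / 4)) (-(σ ^ 2 * t / 2)) t := by
    convert! ((((hasDerivAt_id t).pow 2).const_mul (σ ^ 2)).div_const 4).neg using 1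
    simp only [id]
    push_cast
    ring
  convert! h1.exp using 1
  ring

lemma hasDerivAt_hermiteFun (σ : ℝ) (n : ℕ) (t : ℝ) :
    HasDerivAt (hermiteFun σ n) (hermiteFunDeriv σ n t) t := by
  convert! (hasDerivAt_eval_mul (hermiteR n) σ t).mul (hasDerivAt_gauss σ t) using 1
  unfold hermiteFunDeriv
  ring

/-- The Hermite equation He'' = x He' - n He after scaling by σ; the oscillator frequency is b =
σ²/2. -/
lemma hasDerivAt_hermiteFunDeriv (σ : ℝ) (n : ℕ) (t : ℝ) :
    HasDerivAt (hermiteFunDeriv σ n)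
      (-(oscCoeff (σ ^ 2 / 2) (σ ^ 2 / 2 * (2 * n + 1)) t * hermiteFun σ n t)) t := by
  have h1 := hasDerivAt_eval_mul (hermiteR n) σ t
  have h2 := hasDerivAt_eval_mul (Polynomial.derivative (hermiteR n)) σ t
  have h3 : HasDerivAt (fun t : ℝ => σ ^ 2 * t / 2) (σ ^ 2 / 2) t := by
    simpa using ((hasDerivAt_id t).const_mul (σ ^ 2)).div_const 2
  convert! ((h2.const_mul σ).sub (h3.mul h1)).mul (hasDerivAt_gauss σ t) using 1
  rw [derivative_derivative_hermiteR]
  simp only [Polynomial.eval_sub, Polynomial.eval_mul, Polynomial.eval_X, Polynomial.eval_natCast,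
    Pi.sub_apply, Pi.mul_apply]
  unfold oscCoeff hermiteFun
  ring

variable {i : Fin 2} {k : ℕ}

lemma hermiteR_eval_zero_of_odd {n : ℕ} (hn : Odd n) : (hermiteR n).eval 0 = 0 := by
  have := hermiteR_eval_neg n 0
  rw [neg_zero, hn.neg_one_pow] at this
  linarith

lemma derivative_hermiteR_eval_zero_of_even {n : ℕ} (hn : Even n) :
    (Polynomial.derivative (hermiteR n)).eval 0 = 0 := by
  cases n with
  | zero => simp [hermiteR]
  | succ n =>
    have : Odd n := by
      rw [← Nat.not_even_iff_odd]
      exact fun h => Nat.not_even_iff_odd.2 h.add_one hn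
    rw [derivative_hermiteR_succ, Polynomial.eval_mul, hermiteR_eval_zero_of_odd this, mul_zero]

/-- The Prüfer angle of the rescaled Hermite function of order `2k + i`. -/
def IsHermiteAngle (i : Fin 2) (k : ℕ) (σ : ℝ) (θ : ℝ → ℝ) : Prop :=
  θ 0 = startAngle i ∧ IsPruferAngle (fun _ => 1)
    (oscCoeff (σ ^ 2 / 2) (σ ^ 2 / 2 * (2 * (2 * k + (i : ℕ)) + 1))) θ

lemma exists_isHermiteAngle (i : Fin 2) (k : ℕ) (σ : ℝ) : ∃ θ, IsHermiteAngle i k σ θ :=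
  exists_isPruferAngle continuous_const (continuous_oscCoeff _ _) _

lemma IsHermiteAngle.phase_eq {σ : ℝ} {θ : ℝ → ℝ} (h : IsHermiteAngle i k σ θ) {t : ℝ}
    (ht : 0 ≤ t) : Real.cos (θ t) * hermiteFun σ (2 * k + i) t
      = Real.sin (θ t) * hermiteFunDeriv σ (2 * k + i) t := by
  refine h.2.phase_eq (a := 0) continuous_const (continuous_oscCoeff _ _)
    (u := hermiteFun σ (2 * k + i)) (z := hermiteFunDeriv σ (2 * k + i)) (fun x => ?_)
    (fun x => ?_) ?_ ht
  · rw [one_smul]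
    exact hasDerivAt_hermiteFun _ _ x
  · convert! hasDerivAt_hermiteFunDeriv σ (2 * k + i) x using 1
    push_cast
    rfl
  · rw [h.1]
    unfold startAngle hermiteFun hermiteFunDeriv
    fin_cases i
    · simp [derivative_hermiteR_eval_zero_of_even (even_two_mul k)]
    · simp [hermiteR_eval_zero_of_odd (odd_two_mul_add_one k)]

/-- The angle of the Hermite function of order `2k + i` stays below `(k + 1) π`. -/
lemma IsHermiteAngle.lt {σ : ℝ} (hσ : 0 < σ) {θ : ℝ → ℝ} (h : IsHermiteAngle i k σ θ) {T : ℝ}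
    (hT : 0 ≤ T) : θ T < (k + 1) * π := by
  by_contra! hge
  have hex : ∀ m : Fin (k + 1), ∃ t, 0 < t ∧ θ t = ((m : ℕ) + 1) * π := by
    intro m
    have hm : ((m : ℕ) : ℝ) + 1 ≤ k + 1 := by exact_mod_cast m.2
    have h0 : θ 0 < ((m : ℕ) + 1) * π := by
      rw [h.1]
      have : (0 : ℝ) ≤ (m : ℕ) * π := by positivity
      linarith [startAngle_lt_pi i]
    obtain ⟨t, ht, hte⟩ := intermediate_value_Icc hT h.2.continuous.continuousOn
      ⟨h0.le, (mul_le_mul_of_nonneg_right hm Real.pi_pos.le).trans hge⟩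
    refine ⟨t, lt_of_le_of_ne ht.1 ?_, hte⟩
    rintro rfl
    exact h0.ne hte
  choose t ht0 hte using hex
  have htinj : Function.Injective t := by
    intro m m' hmm
    have := hte m
    rw [hmm, hte m'] at this
    have := mul_right_cancel₀ Real.pi_pos.ne' this
    have : ((m' : ℕ) : ℝ) = (m : ℕ) := by linarith
    exact Fin.ext (by exact_mod_cast this.symm)
  set n := 2 * k + (i : ℕ) with hn
  have hroot : ∀ m, (hermiteR n).eval (σ * t m) = 0 := by
    intro m
    have h1 := h.phase_eq (ht0 m).le
    have h2 : θ (t m) = ((m + 1 : ℕ) : ℝ) * π := by rw [hte]; push_cast; rfl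
    rw [h2, Real.sin_nat_mul_pi, Real.cos_nat_mul_pi, zero_mul, mul_eq_zero] at h1
    have h3 := h1.resolve_left (pow_ne_zero _ (by norm_num))
    exact (mul_eq_zero.1 h3).resolve_right (Real.exp_pos _).ne'
  set S : Finset ℝ := Finset.univ.image fun m => σ * t m with hS
  set S' : Finset ℝ := Finset.univ.image fun m => -(σ * t m) with hS'
  have hdisj : Disjoint S S' := by
    rw [Finset.disjoint_left]
    intro x hx hx'
    obtain ⟨m, -, rfl⟩ := Finset.mem_image.1 hx
    obtain ⟨m', -, hm'⟩ := Finset.mem_image.1 hx'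
    have h1 := mul_pos hσ (ht0 m)
    have h2 := mul_pos hσ (ht0 m')
    linarith
  have hcardS : S.card = k + 1 := by
    rw [hS, Finset.card_image_of_injective _ fun a b hab =>
      htinj (mul_left_cancel₀ hσ.ne' hab), Finset.card_univ, Fintype.card_fin]
  have hcardS' : S'.card = k + 1 := by
    rw [hS', Finset.card_image_of_injective _ fun a b hab =>
      htinj (mul_left_cancel₀ hσ.ne' (neg_injective hab)), Finset.card_univ, Fintype.card_fin]
  have hsub : S ∪ S' ⊆ (hermiteR n).roots.toFinset := by
    intro x hx
    rw [Multiset.mem_toFinset, Polynomial.mem_roots (hermiteR_monic n).ne_zero,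
      Polynomial.IsRoot.def]
    rcases Finset.mem_union.1 hx with hx | hx
    · obtain ⟨m, -, rfl⟩ := Finset.mem_image.1 hx
      exact hroot m
    · obtain ⟨m, -, rfl⟩ := Finset.mem_image.1 hx
      rw [hermiteR_eval_neg, hroot, mul_zero]
  -- The k + 1 positive zeros and their reflections are 2k + 2 roots of a polynomial of degree 2k +
  -- i ≤ 2k + 1.
  have hcard := (Finset.card_le_card hsub).trans ((Multiset.toFinset_card_le _).trans
    (Polynomial.card_roots' (hermiteR n)))
  rw [Finset.card_union_of_disjoint hdisj, hcardS, hcardS', natDegree_hermiteR] at hcard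
  have := i.2
  omega

/-- The cotangent decreases on (0, π); the sign of sin (α - φ) expresses this without division. -/
lemma phase_le_of_cos_le {α φ w : ℝ} (hα : α < π) (hα0 : 0 < α) (hφ : 0 < φ)
    (h1 : Real.cos α = w * Real.sin α) (h2 : Real.cos φ ≤ w * Real.sin φ) : α ≤ φ := by
  by_contra! hlt
  have h3 := Real.sin_pos_of_pos_of_lt_pi (sub_pos.2 hlt) (by linarith)
  have h4 := Real.sin_pos_of_pos_of_lt_pi hα0 hα
  rw [Real.sin_sub, h1] at h3
  nlinarith [mul_nonneg h4.le (sub_nonneg.2 h2)]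

lemma le_phase_of_le_cos {α φ w : ℝ} (hα : α < π) (hα0 : 0 < α) (hφ : φ < π)
    (h1 : Real.cos α = w * Real.sin α) (h2 : w * Real.sin φ ≤ Real.cos φ) : φ ≤ α := by
  by_contra! hlt
  have h3 := Real.sin_pos_of_pos_of_lt_pi (sub_pos.2 hlt) (by linarith)
  have h4 := Real.sin_pos_of_pos_of_lt_pi hα0 hα
  rw [Real.sin_sub, h1] at h3
  nlinarith [mul_nonneg h4.le (sub_nonneg.2 h2)]

/-- Upper bound for the Hermite angle far out. -/
lemma IsHermiteAngle.eventually_le {σ : ℝ} (hσ : 0 < σ) {θ : ℝ → ℝ}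
    (h : IsHermiteAngle i k σ θ) :
    ∀ᶠ t in atTop, θ t ≤ k * π + (π / 2 - Real.arctan (-(σ ^ 2 / 2 * t))) := by
  have hlim : Tendsto (fun t : ℝ => σ * t) atTop atTop := tendsto_id.const_mul_atTop hσ
  filter_upwards [hlim.eventually (eventually_hermiteR_pos (2 * k + i)),
    hlim.eventually (eventually_derivative_hermiteR_nonneg (2 * k + i)), eventually_ge_atTop 0]
    with t h1 h2 ht
  have hph := h.phase_eq ht
  unfold hermiteFun hermiteFunDeriv at hph
  rw [← mul_assoc, ← mul_assoc, mul_left_inj' (Real.exp_pos _).ne'] at hph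
  have hlt := h.lt hσ ht
  set w := -(σ ^ 2 / 2 * t) with hw
  rcases le_or_gt (θ t) (k * π) with hle | hgt
  · linarith [Real.arctan_lt_pi_div_two w]
  have e1 := Real.cos_sub_nat_mul_pi (θ t) k
  have e2 := Real.sin_sub_nat_mul_pi (θ t) k
  set φ := θ t - k * π with hφ
  have hφ0 : 0 < φ := sub_pos.2 hgt
  have hφπ : φ < π := by linarith
  have hsin := Real.sin_pos_of_pos_of_lt_pi hφ0 hφπ
  have key : Real.cos φ * (hermiteR (2 * k + i)).eval (σ * t) = Real.sin φ *
      (σ * (Polynomial.derivative (hermiteR (2 * k + i))).eval (σ * t)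
        - σ ^ 2 * t / 2 * (hermiteR (2 * k + i)).eval (σ * t)) := by
    rw [e1, e2, mul_assoc, hph, mul_assoc]
  have hle : φ ≤ π / 2 - Real.arctan w := by
    refine le_phase_of_le_cos (w := w) (by linarith [Real.neg_pi_div_two_lt_arctan w])
      (by linarith [Real.arctan_lt_pi_div_two w]) hφπ ?_ ?_
    · rw [Real.cos_pi_div_two_sub, Real.sin_pi_div_two_sub]
      conv_rhs => rw [← Real.tan_arctan w]
      rw [Real.arctan_tan (Real.neg_pi_div_two_lt_arctan w) (Real.arctan_lt_pi_div_two w),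
        Real.tan_mul_cos (Real.cos_arctan_pos w).ne']
    · refine le_of_mul_le_mul_right ?_ h1
      rw [key, hw]
      have := mul_nonneg hsin.le (mul_nonneg hσ.le h2)
      linarith
  linarith

/-- Lower bound for the Hermite angle far out, once it has passed `k π`. -/
lemma IsHermiteAngle.eventually_cos_le {σ : ℝ} (hσ : 0 < σ) {θ : ℝ → ℝ}
    (h : IsHermiteAngle i k σ θ) (hk : ∀ᶠ t in atTop, k * π < θ t) :
    ∀ᶠ t in atTop, Real.cos (θ t - k * π) ≤ (σ - σ ^ 2 / 2 * t) * Real.sin (θ t - k * π) := by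
  have hlim : Tendsto (fun t : ℝ => σ * t) atTop atTop := tendsto_id.const_mul_atTop hσ
  filter_upwards [hlim.eventually (eventually_hermiteR_pos (2 * k + i)),
    hlim.eventually (eventually_derivative_hermiteR_le (2 * k + i)), eventually_ge_atTop 0, hk]
    with t h1 h2 ht hgt
  have hph := h.phase_eq ht
  unfold hermiteFun hermiteFunDeriv at hph
  rw [← mul_assoc, ← mul_assoc, mul_left_inj' (Real.exp_pos _).ne'] at hph
  have hlt := h.lt hσ ht
  have e1 := Real.cos_sub_nat_mul_pi (θ t) k
  have e2 := Real.sin_sub_nat_mul_pi (θ t) k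
  set φ := θ t - k * π with hφ
  have hsin := Real.sin_pos_of_pos_of_lt_pi (sub_pos.2 hgt) (show θ t - k * π < π by linarith)
  have key : Real.cos φ * (hermiteR (2 * k + i)).eval (σ * t) = Real.sin φ *
      (σ * (Polynomial.derivative (hermiteR (2 * k + i))).eval (σ * t)
        - σ ^ 2 * t / 2 * (hermiteR (2 * k + i)).eval (σ * t)) := by
    rw [e1, e2, mul_assoc, hph, mul_assoc]
  refine le_of_mul_le_mul_right ?_ h1
  rw [key]
  have := mul_nonneg hsin.le (mul_nonneg hσ.le (sub_nonneg.2 h2))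
  linarith

end

section

/-! ### Oscillation of the harmonic oscillator above an eigenvalue -/

variable {i j : Fin 2} {k : ℕ}

/-- The phase of `(t₁ - t) exp (-b t² / 2)` is a subsolution. -/
lemma IsPruferAngle.ge_of_blowup {b μ t₀ t₁ : ℝ} (hb : 0 < b) (hμ : b ≤ μ) (ht₀ : 0 ≤ t₀)
    (ht : t₀ < t₁) {θ : ℝ → ℝ} (h : IsPruferAngle (fun _ => 1) (oscCoeff b μ) θ)
    (h0 : (k + 1) * π - Real.arctan ((t₁ - t₀) / (1 + b * t₀ * (t₁ - t₀))) ≤ θ t₀) :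
    (k + 1) * π ≤ θ t₁ := by
  have hden : ∀ t ∈ Icc t₀ t₁, 0 < 1 + b * t * (t₁ - t) := fun t ht => by
    have := mul_nonneg (mul_nonneg hb.le (ht₀.trans ht.1)) (sub_nonneg.2 ht.2)
    linarith
  have hd : ∀ t ∈ Icc t₀ t₁, HasDerivAt
      (fun t => (k + 1) * π - Real.arctan ((t₁ - t) / (1 + b * t * (t₁ - t))))
      ((1 + b * (t₁ - t) ^ 2) / ((1 + b * t * (t₁ - t)) ^ 2 + (t₁ - t) ^ 2)) t := by
    intro t ht
    have hN := hden t ht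
    have h1 : HasDerivAt (fun t : ℝ => t₁ - t) (-1) t := (hasDerivAt_id t).const_sub t₁
    have h2 : HasDerivAt (fun t : ℝ => b * t) b t := by
      simpa using (hasDerivAt_id t).const_mul b
    have h3 : HasDerivAt (fun t : ℝ => 1 + b * t * (t₁ - t)) (b * (t₁ - t) - b * t) t := by
      convert! (h2.mul h1).const_add 1 using 1
      ring
    convert! ((h1.div h3 hN.ne').arctan).const_sub (((k : ℝ) + 1) * π) using 1
    simp only [Pi.div_apply]
    field_simp
    ring
  have := h.ge_of_subsolution continuous_const (continuous_oscCoeff b μ)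
    (fun t ht => (hd t ht).continuousAt.continuousWithinAt)
    (fun t ht => (hd t ⟨ht.1, ht.2.le⟩).hasDerivWithinAt) (fun t ht => ?_) h0 t₁ ⟨ht.le, le_rfl⟩
  · simpa using this
  · have hN := hden t ⟨ht.1, ht.2.le⟩
    have hD : 0 ≤ t₁ - t := sub_nonneg.2 ht.2.le
    have htt : 0 ≤ t := ht₀.trans ht.1
    set D := t₁ - t with hDdef
    set N := 1 + b * t * D with hNdef
    have e1 : Real.sin ((k + 1) * π - Real.arctan (D / N)) ^ 2 = D ^ 2 / (N ^ 2 + D ^ 2) := by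
      have : Real.sin (((k + 1 : ℕ) : ℝ) * π - Real.arctan (D / N)) ^ 2
          = Real.sin (Real.arctan (D / N)) ^ 2 := by
        rw [Real.sin_nat_mul_pi_sub, neg_sq, mul_pow, ← pow_mul, mul_comm (k + 1) 2, pow_mul]
        norm_num
      push_cast at this
      rw [this, Real.sin_sq, Real.cos_sq_arctan]
      field_simp
      ring
    unfold pruferField oscCoeff
    rw [Real.cos_sq', e1]
    have hND : 0 < N ^ 2 + D ^ 2 := by positivity
    have e2 : 1 * (1 - D ^ 2 / (N ^ 2 + D ^ 2)) + (μ - b ^ 2 * t ^ 2) * (D ^ 2 / (N ^ 2 + D ^ 2))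
        = (N ^ 2 + (μ - b ^ 2 * t ^ 2) * D ^ 2) / (N ^ 2 + D ^ 2) := by
      field_simp
      ring
    rw [e2]
    refine div_le_div_of_nonneg_right ?_ hND.le
    have e3 : N ^ 2 + (μ - b ^ 2 * t ^ 2) * D ^ 2 = 1 + 2 * (b * t * D) + μ * D ^ 2 := by
      rw [hNdef]; ring
    have e4 : 0 ≤ b * t * D := by positivity
    have e5 := mul_le_mul_of_nonneg_right hμ (sq_nonneg D)
    linarith

/-- If the Hermite angles of index `k` pass `k π`, then every oscillator angle of larger energy
passes `(k + 1) π`. -/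
lemma exists_lt_oscillatorAngle_of_hermite {b μ : ℝ} (hb : 0 < b)
    (hμ : b * (2 * (2 * k + (i : ℕ)) + 1) < μ)
    (hH : ∀ {σ : ℝ} {ψ : ℝ → ℝ}, 0 < σ → IsHermiteAngle i k σ ψ → ∀ᶠ t in atTop, k * π < ψ t)
    {θ : ℝ → ℝ} (h0 : θ 0 = startAngle i) (h : IsPruferAngle (fun _ => 1) (oscCoeff b μ) θ) :
    ∃ T, 0 < T ∧ (k + 1) * π < θ T := by
  set c : ℝ := 2 * (2 * k + (i : ℕ)) + 1 with hc
  have hc1 : 1 ≤ c := by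
    rw [hc]
    have : (0 : ℝ) ≤ 2 * (2 * k + (i : ℕ)) := by positivity
    linarith
  have hc0 : 0 < c := by linarith
  -- The energy surplus is spent on a frequency b' > b: its Hermite phase is still below θ, and its
  -- solution decays faster than exp(-b t²/2).
  obtain ⟨b', hbb', hb'⟩ := exists_between ((lt_div_iff₀ hc0).2 hμ)
  rw [lt_div_iff₀ hc0] at hb'
  have hb'0 : 0 < b' := hb.trans hbb'
  set σ := Real.sqrt (2 * b') with hσ
  have hσ0 : 0 < σ := Real.sqrt_pos.2 (by positivity)
  have hσ2 : σ ^ 2 / 2 = b' := by rw [hσ, Real.sq_sqrt (by positivity)]; ring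
  obtain ⟨ψ, hψ⟩ := exists_isHermiteAngle i k σ
  -- From here on σ - b' X ≤ -(1 + b X), and the right side is the logarithmic derivative at X of (X
  -- + 1 - t) exp(-b t²/2). That function vanishes at X + 1, so θ has reached (k + 1)π there.
  obtain ⟨X, hX1, hX2, hX3, hX0⟩ := ((hH hσ0 hψ).and ((hψ.eventually_cos_le hσ0 (hH hσ0 hψ)).and
    ((eventually_ge_atTop ((1 + σ) / (b' - b))).and (eventually_gt_atTop 0)))).exists
  rw [div_le_iff₀ (sub_pos.2 hbb')] at hX3
  rw [hσ2] at hX2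
  have hψ2 := hψ.2
  rw [hσ2] at hψ2
  have hcmp := hψ2.le_of_le continuous_const (continuous_oscCoeff _ _) h (a := 0) (b := X)
    (fun t _ => by
      unfold oscCoeff
      have : b ^ 2 * t ^ 2 ≤ b' ^ 2 * t ^ 2 := by gcongr
      linarith) (by rw [hψ.1, h0]) X ⟨hX0.le, le_rfl⟩
  have hlt := hψ.lt hσ0 hX0.le
  have hN : 0 < 1 + b * X * (X + 1 - X) := by
    rw [show X + 1 - X = 1 by ring, mul_one]; positivity
  have hg0 : 0 < (X + 1 - X) / (1 + b * X * (X + 1 - X)) := by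
    apply div_pos _ hN
    linarith
  have hphase : π - Real.arctan ((X + 1 - X) / (1 + b * X * (X + 1 - X))) ≤ ψ X - k * π := by
    set g := (X + 1 - X) / (1 + b * X * (X + 1 - X)) with hg
    have hg' : (1 + b * X) * g = 1 := by
      rw [hg]
      have : X + 1 - X = 1 := by ring
      rw [this, mul_one] at hN ⊢
      exact mul_one_div_cancel hN.ne'
    have hsin := Real.sin_pos_of_pos_of_lt_pi (sub_pos.2 hX1) (show ψ X - k * π < π by linarith)
    refine phase_le_of_cos_le (w := -(1 + b * X)) (by linarith [Real.arctan_pos.2 hg0])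
      (by linarith [Real.arctan_lt_pi_div_two g, Real.pi_pos]) (sub_pos.2 hX1) ?_
      (hX2.trans (mul_le_mul_of_nonneg_right (by linarith) hsin.le))
    rw [Real.cos_pi_sub, Real.sin_pi_sub]
    have h1 : Real.sin (Real.arctan g) = g * Real.cos (Real.arctan g) := by
      rw [← Real.tan_mul_cos (Real.cos_arctan_pos g).ne', Real.tan_arctan]
    rw [h1]
    linear_combination Real.cos (Real.arctan g) * hg'
  have hbμ : b ≤ μ := by nlinarith
  have hend := h.ge_of_blowup (k := k) hb hbμ hX0.le (show X < X + 1 by linarith) (by linarith)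
  refine ⟨X + 2, by linarith, ?_⟩
  have := h.int_mul_pi_lt (m := (k + 1 : ℕ)) (a := X + 1) (x := X + 2) continuous_const
    (continuous_oscCoeff _ _) (fun _ => one_pos) (by push_cast; exact hend) (by linarith)
  exact_mod_cast this

/-- Above `b (2 (2k + i) + 1)` the angle of the oscillator `-u'' + b² t² u = μ u`
passes `(k + 1) π`. -/
theorem exists_lt_oscillatorAngle (i : Fin 2) (k : ℕ) {b μ : ℝ} (hb : 0 < b)
    (hμ : b * (2 * (2 * k + (i : ℕ)) + 1) < μ) {θ : ℝ → ℝ} (h0 : θ 0 = startAngle i)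
    (h : IsPruferAngle (fun _ => 1) (oscCoeff b μ) θ) :
    ∃ T, 0 < T ∧ (k + 1) * π < θ T := by
  induction k generalizing b μ θ with
  | zero =>
    refine exists_lt_oscillatorAngle_of_hermite hb hμ (fun {σ ψ} _ hψ => ?_) h0 h
    filter_upwards [eventually_gt_atTop 0] with t ht
    have := hψ.2.int_mul_pi_lt (m := 0) (a := 0) continuous_const (continuous_oscCoeff _ _)
      (fun _ => one_pos) (by simpa [hψ.1] using startAngle_nonneg i) ht
    simpa using this
  | succ k ih =>
    refine exists_lt_oscillatorAngle_of_hermite hb hμ (fun {σ ψ} hσ hψ => ?_) h0 h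
    have hσ2 : 0 < σ ^ 2 / 2 := by positivity
    -- The Hermite energy of index k + 1 lies strictly above that of index k at the same frequency,
    -- so the induction hypothesis applies to the Hermite angle itself.
    obtain ⟨T, hT0, hT⟩ := ih hσ2 (mul_lt_mul_of_pos_left (by push_cast; linarith) hσ2) hψ.1 hψ.2
    filter_upwards [eventually_ge_atTop T] with t ht
    rcases ht.eq_or_lt with rfl | hlt
    · push_cast; exact hT
    · have := hψ.2.int_mul_pi_lt (m := (k + 1 : ℕ)) (a := T) continuous_const
        (continuous_oscCoeff _ _) (fun _ => one_pos) (by push_cast; exact hT.le) hlt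
      exact_mod_cast this

/-! ### Growth of the eigenvalues -/

/-- The Prüfer angle of the Mathieu equation at `λ = μ κ²`, `q = κ⁴`, in the variable `κ x`. -/
lemma isPruferAngle_scaled {κ : ℝ} (hκ : 0 < κ) (i : Fin 2) (μ : ℝ) :
    IsPruferAngle (fun _ => 1) (fun t => μ - κ ^ 2 * Real.sin (t / κ) ^ 2)
      (fun t => mathieuAngle κ i (μ * κ ^ 2) (κ ^ 4) (t / κ)) := by
  intro t
  have h1 : HasDerivAt (fun t : ℝ => t / κ) (1 / κ) t := (hasDerivAt_id t).div_const κ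
  convert! (isPruferAngle_mathieuAngle κ i (μ * κ ^ 2) (κ ^ 4) (t / κ)).comp t h1 using 1
  unfold pruferField mathieuCoeff
  field_simp

/-- Since κ² sin²(t/κ) ≤ t², the scaled Mathieu phase dominates the oscillator phase. The latter
passes (k + 1)π at a time T independent of κ, and T ≤ κ π/2 eventually. -/
lemma level_le_mul_sq (i j : Fin 2) (k : ℕ) {μ : ℝ} (hμ : 2 * (2 * k + (i : ℕ)) + 1 < μ) :
    ∀ᶠ κ in atTop, level i j k (κ ^ 4) ≤ μ * κ ^ 2 := by
  obtain ⟨ψ, hψ0, hψ⟩ := exists_isPruferAngle (P := fun _ => 1) continuous_const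
    (continuous_oscCoeff 1 μ) (startAngle i)
  obtain ⟨T, hT0, hT⟩ := exists_lt_oscillatorAngle i k one_pos (by rwa [one_mul]) hψ0 hψ
  filter_upwards [eventually_gt_atTop 0, eventually_ge_atTop (T / (π / 2))] with κ hκ hκT
  rw [div_le_iff₀ (by positivity)] at hκT
  have hs := isPruferAngle_scaled hκ i μ
  have hQ : Continuous (fun t => μ - κ ^ 2 * Real.sin (t / κ) ^ 2) := by fun_prop
  have h1 := hψ.le_of_le continuous_const (continuous_oscCoeff 1 μ) hs (a := 0) (b := T)
    (fun t ht => by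
      unfold oscCoeff
      have h2 : Real.sin (t / κ) ^ 2 ≤ (t / κ) ^ 2 := by
        rw [← sq_abs (Real.sin _), ← sq_abs (t / κ)]
        exact pow_le_pow_left₀ (abs_nonneg _) Real.abs_sin_le_abs 2
      have h3 : κ ^ 2 * Real.sin (t / κ) ^ 2 ≤ κ ^ 2 * (t / κ) ^ 2 := by gcongr
      have h4 : κ ^ 2 * (t / κ) ^ 2 = t ^ 2 := by field_simp
      linarith) (by simp [hψ0]) T ⟨hT0.le, le_rfl⟩
  have h2 := hs.int_mul_pi_le (m := (k + 1 : ℕ)) continuous_const hQ (fun _ => one_pos)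
    (by push_cast; exact hT.le.trans h1) hκT
  rw [mul_div_cancel_left₀ _ hκ.ne'] at h2
  push_cast at h2
  rw [← not_lt, lt_level_iff hκ, not_lt]
  exact (targetAngle_le i j k).trans h2

lemma mul_sq_le_level (i j : Fin 2) (k : ℕ) {μ : ℝ} (hμ : μ < 2 * (2 * k + (i : ℕ)) + 1) :
    ∀ᶠ κ in atTop, μ * κ ^ 2 ≤ level i j k (κ ^ 4) := by
  set c : ℝ := 2 * (2 * k + (i : ℕ)) + 1 with hc
  have hc0 : 0 < c := by positivity
  -- The flattened oscillator of frequency a < 1 must still have its level a c above μ; the maximum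
  -- with 0 covers negative μ.
  obtain ⟨a, ha, ha1⟩ := exists_between (max_lt ((div_lt_one hc0).2 hμ) one_pos)
  have ha0 : 0 < a := (le_max_right _ _).trans_lt ha
  have haμ : μ < a * c := (div_lt_iff₀ hc0).1 ((le_max_left _ _).trans_lt ha)
  set δ := 1 - a with hδ
  have hδ0 : 0 < δ := by linarith
  have hδ1 : δ < 1 := by linarith
  have hπ := Real.pi_gt_three
  -- The radius δ = 1 - a suffices because x² ≤ δ² ≤ 1 - a controls the cubic error of the sine.
  have hsin : ∀ x, 0 < x → x ≤ δ → a * x < Real.sin x := by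
    intro x hx hxδ
    have := Real.sin_gt_sub_cube hx
    have h1 : x * x ≤ 1 - a := by nlinarith
    nlinarith
  set σ := Real.sqrt (2 * a) with hσ
  have hσ0 : 0 < σ := Real.sqrt_pos.2 (by positivity)
  have hσ2 : σ ^ 2 / 2 = a := by rw [hσ, Real.sq_sqrt (by positivity)]; ring
  obtain ⟨ψ, hψ⟩ := exists_isHermiteAngle i k σ
  have hfar := hψ.eventually_le hσ0
  have hψ2 := hψ.2
  rw [hσ2] at hfar hψ2
  -- The slope for which w below rises linearly from -aκδ at t = κδ, the cotangent of the Hermite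
  -- bound, to 0 at t = κπ/2.
  set m : ℝ := a * δ / (π / 2 - δ) with hm
  have hπδ : 0 < π / 2 - δ := by linarith
  have hgap : 0 < Real.sin δ ^ 2 - (a * δ) ^ 2 := by
    have := hsin δ hδ0 le_rfl
    have : 0 < a * δ := by positivity
    nlinarith
  have hlimδ : Tendsto (fun κ : ℝ => κ * δ) atTop atTop := tendsto_id.atTop_mul_const hδ0
  have hlimg : Tendsto (fun κ : ℝ => κ ^ 2 * (Real.sin δ ^ 2 - (a * δ) ^ 2)) atTop atTop :=
    (tendsto_pow_atTop two_ne_zero).atTop_mul_const hgap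
  filter_upwards [eventually_gt_atTop 0, hlimδ.eventually hfar,
    hlimg.eventually_ge_atTop (m + μ)] with κ hκ hκ1 hκ2
  have hs := isPruferAngle_scaled hκ i μ
  have hQ : Continuous (fun t => μ - κ ^ 2 * Real.sin (t / κ) ^ 2) := by fun_prop
  have hT0 : 0 < κ * δ := by positivity
  have hTE : κ * δ < κ * (π / 2) := by gcongr; linarith
  have h1 := hs.le_of_le continuous_const hQ hψ2 (a := 0) (b := κ * δ)
    (fun t ht => by
      unfold oscCoeff
      have h2 : a * (t / κ) ≤ Real.sin (t / κ) := by
        rcases ht.1.eq_or_lt with rfl | htpos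
        · simp
        · refine (hsin _ (by positivity) ?_).le
          rw [div_le_iff₀ hκ]
          linarith [ht.2]
      have h3 : (a * (t / κ)) ^ 2 ≤ Real.sin (t / κ) ^ 2 :=
        pow_le_pow_left₀ (mul_nonneg ha0.le (div_nonneg ht.1 hκ.le)) h2 2
      have h4 : κ ^ 2 * (a * (t / κ)) ^ 2 ≤ κ ^ 2 * Real.sin (t / κ) ^ 2 := by gcongr
      have h5 : κ ^ 2 * (a * (t / κ)) ^ 2 = a ^ 2 * t ^ 2 := by field_simp
      linarith) (by simp [hψ.1]) (κ * δ) ⟨hT0.le, le_rfl⟩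
  set w : ℝ → ℝ := fun t => m * (t - κ * (π / 2)) with hw
  have hwd : ∀ t, HasDerivAt w m t := fun t => by
    simpa using ((hasDerivAt_id t).sub_const (κ * (π / 2))).const_mul m
  have hwT : w (κ * δ) = -(a * (κ * δ)) := by
    have hmδ : m * (π / 2 - δ) = a * δ := div_mul_cancel₀ _ hπδ.ne'
    simp only [hw]
    linear_combination (-κ) * hmδ
  have hvd : ∀ t, HasDerivAt (fun t => k * π + (π / 2 - Real.arctan (w t)))
      (-m / (1 + w t ^ 2)) t := fun t => by
    convert! (((hwd t).arctan).const_sub (π / 2)).const_add (k * π) using 1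
    ring
  -- The angle in (kπ, (k + 1)π) with cotangent w is a supersolution if m + μ + w² ≤ κ² sin²(t/κ).
  -- This holds for large κ since w² ≤ κ²(aδ)² and aδ < sin δ. It ends at kπ + π/2, which no target
  -- of index k lies below.
  have h2 := hs.le_of_supersolution continuous_const hQ (a := κ * δ) (b := κ * (π / 2))
    (fun t _ => (hvd t).continuousAt.continuousWithinAt) (fun t _ => (hvd t).hasDerivWithinAt)
    (fun t ht => ?_) (by rw [hwT]; exact h1.trans hκ1) (κ * (π / 2)) ⟨hTE.le, le_rfl⟩
  · have hwE : w (κ * (π / 2)) = 0 := by simp [hw]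
    simp only [hwE, Real.arctan_zero, sub_zero, mul_div_cancel_left₀ _ hκ.ne'] at h2
    rw [← not_lt, level_lt_iff hκ, not_lt]
    exact h2.trans (le_targetAngle i j k)
  · have hsq : Real.cos (k * π + (π / 2 - Real.arctan (w t))) ^ 2
        = Real.sin (Real.arctan (w t)) ^ 2 := by
      rw [add_comm, Real.cos_add_nat_mul_pi, mul_pow, ← pow_mul, mul_comm k 2, pow_mul,
        Real.cos_pi_div_two_sub]
      norm_num
    unfold pruferField
    rw [Real.sin_sq (k * π + (π / 2 - Real.arctan (w t))), hsq, ← Real.cos_sq', Real.sin_sq,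
      Real.cos_sq_arctan]
    have hpos : 0 < 1 + w t ^ 2 := by positivity
    have e1 : 1 * (1 - 1 / (1 + w t ^ 2)) + (μ - κ ^ 2 * Real.sin (t / κ) ^ 2)
        * (1 / (1 + w t ^ 2)) = (w t ^ 2 + μ - κ ^ 2 * Real.sin (t / κ) ^ 2) / (1 + w t ^ 2) := by
      field_simp
      ring
    rw [e1]
    refine div_le_div_of_nonneg_right ?_ hpos.le
    have hm0 : 0 ≤ m := by positivity
    have hw0 : w t ≤ 0 := mul_nonpos_of_nonneg_of_nonpos hm0 (sub_nonpos.2 ht.2.le)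
    have hwge : -(a * (κ * δ)) ≤ w t := by
      rw [← hwT]
      simp only [hw]
      exact mul_le_mul_of_nonneg_left (by linarith [ht.1]) hm0
    have hwsq : w t ^ 2 ≤ κ ^ 2 * (a * δ) ^ 2 := by
      have : w t ^ 2 ≤ (a * (κ * δ)) ^ 2 := by nlinarith
      linarith [show (a * (κ * δ)) ^ 2 = κ ^ 2 * (a * δ) ^ 2 by ring]
    have hsδ : Real.sin δ ≤ Real.sin (t / κ) := by
      have h3 : δ ≤ t / κ := by rw [le_div_iff₀ hκ]; linarith [ht.1]
      have h4 : t / κ ≤ π / 2 := by rw [div_le_iff₀ hκ]; linarith [ht.2]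
      exact Real.sin_le_sin_of_le_of_le_pi_div_two (by linarith) h4 h3
    have hsδ0 : 0 < Real.sin δ := lt_trans (by positivity) (hsin δ hδ0 le_rfl)
    have hsq' : κ ^ 2 * Real.sin δ ^ 2 ≤ κ ^ 2 * Real.sin (t / κ) ^ 2 := by gcongr
    linarith

theorem tendsto_level_div (i j : Fin 2) (k : ℕ) :
    Tendsto (fun q => level i j k q / q ^ (1 / 2 : ℝ)) atTop
      (𝓝 (2 * (2 * (k : ℝ) + ((i : ℕ) : ℝ)) + 1)) := by
  have hκ : Tendsto (fun q : ℝ => q ^ (1 / 4 : ℝ)) atTop atTop :=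
    tendsto_rpow_atTop (by norm_num)
  have hpow : ∀ q : ℝ, 0 < q → (q ^ (1 / 4 : ℝ)) ^ 4 = q ∧
      (q ^ (1 / 4 : ℝ)) ^ 2 = q ^ (1 / 2 : ℝ) := by
    intro q hq
    rw [← Real.rpow_natCast, ← Real.rpow_natCast, ← Real.rpow_mul hq.le, ← Real.rpow_mul hq.le]
    norm_num
  refine tendsto_order.2 ⟨fun a ha => ?_, fun a ha => ?_⟩
  · obtain ⟨μ, haμ, hμ⟩ := exists_between ha
    filter_upwards [hκ.eventually (mul_sq_le_level i j k hμ), eventually_gt_atTop 0] with q h1 hq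
    rw [(hpow q hq).1, (hpow q hq).2] at h1
    exact haμ.trans_le ((le_div_iff₀ (Real.rpow_pos_of_pos hq _)).2 h1)
  · obtain ⟨μ, hμ, hμa⟩ := exists_between ha
    filter_upwards [hκ.eventually (level_le_mul_sq i j k hμ), eventually_gt_atTop 0] with q h1 hq
    rw [(hpow q hq).1, (hpow q hq).2] at h1
    exact ((div_le_iff₀ (Real.rpow_pos_of_pos hq _)).2 h1).trans_lt hμa

end

end Mathieu

theorem proposition7p4 (i j : Fin 2) :
    (∀ q : ℝ, StrictMono (fun k : ℕ => Mathieu.eigenvalue i j k q) ∧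
      Set.range (fun k : ℕ => Mathieu.eigenvalue i j k q) = Mathieu.eigenvalueSet i j q) ∧
    ∀ k : ℕ,
      Differentiable ℝ (Mathieu.eigenvalue i j k) ∧
      Tendsto (fun q : ℝ => Mathieu.eigenvalue i j k q / q ^ (1 / 2 : ℝ)) atTop
        (𝓝 (2 * (2 * (k : ℝ) + ((i : ℕ) : ℝ)) + 1)) ∧
      Tendsto (fun q : ℝ => q * deriv (Mathieu.eigenvalue i j k) q / Mathieu.eigenvalue i j k q)
        atTop (𝓝 (1 / 2)) := by
  have heq : ∀ k, Mathieu.eigenvalue i j k = Mathieu.level i j k := fun k =>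
    funext fun q => Mathieu.eigenvalue_eq_level i j k q
  simp only [heq]
  exact ⟨fun q => ⟨Mathieu.level_strictMono i j q, Mathieu.range_level_eq i j q⟩, fun k =>
    ⟨fun q => (Mathieu.hasDerivAt_level i j k q).differentiableAt,
      Mathieu.tendsto_level_div i j k,
      Mathieu.tendsto_mul_deriv_level_div (by positivity) (Mathieu.tendsto_level_div i j k)⟩⟩
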